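/- **System.** Let $A$ be a finite set of modes, $F(a)\in\mathbb R^{m\times m}$, $G(a)\in\mathbb R^{m\times r}$ for $a\in A$, and let $\mathrm{Cov}_w\in\mathbb R^{r\times r}$ be a covariance matrix such that $G(a)\,\mathrm{Cov}_w\,G(a)^T$ is positive definite for every $a$. Let $T(\cdot\mid x,a)$ be the law of $F(a)x+G(a)w$ with $w\sim\mathcal N(0,\mathrm{Cov}_w)$. A (measurable) switching strategy maps each finite path $s_0\dots s_k$ of hybrid states $s_i=(a_i,x_i)\in A\times\mathbb R^m$ to a mode $a$; then $s_{k+1}=(a,x_{k+1})$ with $x_{k+1}\sim T(\cdot\mid x_k,a)$. Let $X\subset\mathbb R^m$ be compact and let $r_1,\dots,r_n\subseteq X$ be closed regions, with atomic propositions $\Upsilon=\{p_1,\dots,p_n\}$; a state $(a,x)$ has the label $\{p_i: x\in r_i\}$. **Specification.** Let $\phi$ be a co-safe LTL formula (built from $p,\neg p,\vee,\wedge,\mathcal X,\mathcal U,\mathcal F$) or a bounded LTL formula (built from $p,\neg,\vee,\mathcal X,\mathcal U^{\le k},\mathcal F^{\le k},\mathcal G^{\le k}$) over $\Upsilon$.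 A finite trace over $2^\Upsilon$ is a good prefix of $\phi$ if all its infinite extensions satisfy $\phi$. Let $P(\phi\mid s_0,X,\sigma)$ be the probability, under the strategy $\sigma$ from $s_0$, that some finite prefix of the path stays in $A\times X$ and its trace is a good prefix of $\phi$. Put $r_{n+i}=X\setminus r_i$, let $p_{n+i}$ be new propositions, $\bar\Upsilon=\{p_1,\dots,p_{2n}\}$, and let $\bar\phi$ be obtained from $\phi$ by pushing negations to the atoms and replacing $\neg p_i$ by $p_{n+i}$. Let $\mathcal A=(Z,2^{\bar\Upsilon},\tau,z_0,Z_{ac})$ be a deterministic finite automaton that accepts exactly the words $w$ over $2^{\bar\Upsilon}$ such that $w\xi$ satisfies $\bar\phi$ for every infinite trace $\xi$ over $2^{\Upsilon}$ (read over $2^{\bar\Upsilon}$ by adding $p_{n+i}$ wherever $p_i$ is absent). **Abstraction.** For each mode $a$ let $X$ be the union of a finite set $Q^a$ of full-dimensional convex polytopes (cells) that pairwise overlap only in Lebesgue null sets; the cells need not respect the regions $r_i$. Let $Q=\bigcup_aQ^a\cup\{q_u\}$, where $q_u$ stands for the complement of $A\times X$. For a cell $q$, an action $a\in A$ and $q'\in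 Q^a$ the interval of transition probabilities is $[\min_{x\in q}T(q'\mid x,a),\max_{x\in q}T(q'\mid x,a)]$; it is $[1-\max_{x\in q}T(X\mid x,a),\,1-\min_{x\in q}T(X\mid x,a)]$ for $q'=q_u$ and $\{0\}$ for cells of other modes; $q_u$ is absorbing. Let $\Gamma_q^a$ be the set of probability distributions on $Q$ within these intervals. For $1\le i\le 2n$ and a cell $q$ define the under-approximating labelling by $p_i\in L(q)\iff q\subseteq r_i$ and the over-approximating labelling by $p_i\in L'(q)\iff q\cap r_i\ne\emptyset$; $L(q_u)=L'(q_u)=\emptyset$. **Bellman values.** On $Q\times Z$ let $\check p$ be the limit of the recursive evaluations, started from the indicator function of $Q\times Z_{ac}$, of $$\check p(q,z)=1\ \text{ if } z\in Z_{ac},\qquad \check p(q,z)=\max_{a\in A}\min_{\gamma\in\Gamma_q^a}\sum_{q'\in Q}\gamma(q')\,\check p\big(q',\tau(z,L(q'))\big)\ \text{ otherwise.}$$ Let $\sigma^*:Q\times Z\to A$ be an optimal stationary strategy, that is, the recursive evaluations with $a=\sigma^*(q,z)$ in place of the maximum have the same limit $\check p$. On $Q\times Z\times Z$ let $\hat p$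 be the limit of the recursive evaluations, started from the indicator function of $\{z'\in Z_{ac}\}$, of $$\hat p(q,z,z')=1\ \text{ if } z'\in Z_{ac},\qquad \hat p(q,z,z')=\max_{\gamma\in\Gamma_q^{\sigma^*(q,z)}}\sum_{q'\in Q}\gamma(q')\,\hat p\big(q',\tau(z,L(q')),\tau(z',L'(q'))\big)\ \text{ otherwise;}$$ this is the upper Bellman value for the labelling $L'$ under $\sigma^*$, where $z$ is the memory of $\sigma^*$. Assign measurably to each $(a,x)$ with $x\in X$ a cell of $Q^a$ that contains $x$, and $q_u$ to the other states. Refine $\sigma^*$ to the switching strategy that on $s_0\dots s_k$, with assigned abstract states $q_0\dots q_k$, chooses the mode $\sigma^*(q_k,z)$, where $z$ is the state of $\mathcal A$ after reading $L(q_0)\dots L(q_k)$; call it $\sigma^*$ again. **Claim.** For every $s_0\in A\times X$, with assigned cell $q$, $$\check p\big(q,\tau(z_0,L(q))\big)\ \le\ P(\phi\mid s_0,X,\sigma^*)\ \le\ \hat p\big(q,\tau(z_0,L(q)),\tau(z_0,L'(q))\big).$$ -/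

import Mathlib

open MeasureTheory ProbabilityTheory

/-! ## Temporal logic -/

/-- The trace `w` followed by the infinite trace `ξ`. -/
def appendTrace {α : Type*} (w : List α) (ξ : ℕ → α) (n : ℕ) : α :=
  if h : n < w.length then w[n] else ξ (n - w.length)

/-- The `k`-th suffix of an infinite trace. -/
def traceSuffix {α : Type*} (ξ : ℕ → α) (k : ℕ) : ℕ → α := fun i => ξ (k + i)

/-- Syntax of co-safe linear temporal logic. -/
inductive CsLTL (Υ : Type*) where
  | atom (p : Υ)
  | negAtom (p : Υ)
  | or (φ ψ : CsLTL Υ)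
  | and (φ ψ : CsLTL Υ)
  | next (φ : CsLTL Υ)
  | untl (φ ψ : CsLTL Υ)
  | ev (φ : CsLTL Υ)

/-- Syntax of bounded linear temporal logic. -/
inductive BLTL (Υ : Type*) where
  | atom (p : Υ)
  | neg (φ : BLTL Υ)
  | or (φ ψ : BLTL Υ)
  | next (φ : BLTL Υ)
  | untlLe (k : ℕ) (φ ψ : BLTL Υ)
  | evLe (k : ℕ) (φ : BLTL Υ)
  | alwLe (k : ℕ) (φ : BLTL Υ)

/-- Negation-free formulas: the target of the translation that turns negated atomic propositions
into atomic propositions of their own. -/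
inductive PosLTL (α : Type*) where
  | atom (p : α)
  | or (φ ψ : PosLTL α)
  | and (φ ψ : PosLTL α)
  | next (φ : PosLTL α)
  | untl (φ ψ : PosLTL α)
  | ev (φ : PosLTL α)
  | untlLe (k : ℕ) (φ ψ : PosLTL α)
  | evLe (k : ℕ) (φ : PosLTL α)
  | alwLe (k : ℕ) (φ : PosLTL α)

/-- Satisfaction of a co-safe formula by an infinite trace. -/
def CsLTL.Sat {Υ : Type*} : CsLTL Υ → (ℕ → Set Υ) → Prop
  | .atom p, ξ => p ∈ ξ 0
  | .negAtom p, ξ => p ∉ ξ 0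
  | .or φ ψ, ξ => φ.Sat ξ ∨ ψ.Sat ξ
  | .and φ ψ, ξ => φ.Sat ξ ∧ ψ.Sat ξ
  | .next φ, ξ => φ.Sat (traceSuffix ξ 1)
  | .untl φ ψ, ξ => ∃ k, ψ.Sat (traceSuffix ξ k) ∧ ∀ i < k, φ.Sat (traceSuffix ξ i)
  | .ev φ, ξ => ∃ k, φ.Sat (traceSuffix ξ k)

/-- Satisfaction of a bounded formula by an infinite trace. -/
def BLTL.Sat {Υ : Type*} : BLTL Υ → (ℕ → Set Υ) → Prop
  | .atom p, ξ => p ∈ ξ 0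
  | .neg φ, ξ => ¬ φ.Sat ξ
  | .or φ ψ, ξ => φ.Sat ξ ∨ ψ.Sat ξ
  | .next φ, ξ => φ.Sat (traceSuffix ξ 1)
  | .untlLe k φ ψ, ξ =>
      ∃ j ≤ k, ψ.Sat (traceSuffix ξ j) ∧ ∀ i < j, φ.Sat (traceSuffix ξ i)
  | .evLe k φ, ξ => ∃ j ≤ k, φ.Sat (traceSuffix ξ j)
  | .alwLe k φ, ξ => ∀ j ≤ k, φ.Sat (traceSuffix ξ j)

/-- Satisfaction of a negation-free formula by an infinite trace. -/
def PosLTL.Sat {α : Type*} : PosLTL α → (ℕ → Set α) → Prop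
  | .atom p, ξ => p ∈ ξ 0
  | .or φ ψ, ξ => φ.Sat ξ ∨ ψ.Sat ξ
  | .and φ ψ, ξ => φ.Sat ξ ∧ ψ.Sat ξ
  | .next φ, ξ => φ.Sat (traceSuffix ξ 1)
  | .untl φ ψ, ξ => ∃ k, ψ.Sat (traceSuffix ξ k) ∧ ∀ i < k, φ.Sat (traceSuffix ξ i)
  | .ev φ, ξ => ∃ k, φ.Sat (traceSuffix ξ k)
  | .untlLe k φ ψ, ξ =>
      ∃ j ≤ k, ψ.Sat (traceSuffix ξ j) ∧ ∀ i < j, φ.Sat (traceSuffix ξ i)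
  | .evLe k φ, ξ => ∃ j ≤ k, φ.Sat (traceSuffix ξ j)
  | .alwLe k φ, ξ => ∀ j ≤ k, φ.Sat (traceSuffix ξ j)

/-- Replace `p` by `Sum.inl p` and `¬ p` by `Sum.inr p`. -/
def CsLTL.bar {Υ : Type*} : CsLTL Υ → PosLTL (Υ ⊕ Υ)
  | .atom p => .atom (.inl p)
  | .negAtom p => .atom (.inr p)
  | .or φ ψ => .or φ.bar ψ.bar
  | .and φ ψ => .and φ.bar ψ.bar
  | .next φ => .next φ.bar
  | .untl φ ψ => .untl φ.bar ψ.bar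
  | .ev φ => .ev φ.bar

/-- `BLTL.barAux true φ` and `BLTL.barAux false φ` are the translations of `φ` and of `¬ φ`:
negations are pushed to the atoms and then `p` becomes `Sum.inl p` and `¬ p` becomes `Sum.inr p`.
The negation of `φ U^{≤ k} ψ` is `G^{≤ k} ¬ ψ ∨ (¬ ψ U^{≤ k} (¬ φ ∧ ¬ ψ))`. -/
def BLTL.barAux {Υ : Type*} : Bool → BLTL Υ → PosLTL (Υ ⊕ Υ)
  | true, .atom p => .atom (.inl p)
  | false, .atom p => .atom (.inr p)
  | true, .neg φ => φ.barAux false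
  | false, .neg φ => φ.barAux true
  | true, .or φ ψ => .or (φ.barAux true) (ψ.barAux true)
  | false, .or φ ψ => .and (φ.barAux false) (ψ.barAux false)
  | true, .next φ => .next (φ.barAux true)
  | false, .next φ => .next (φ.barAux false)
  | true, .untlLe k φ ψ => .untlLe k (φ.barAux true) (ψ.barAux true)
  | false, .untlLe k φ ψ =>
      .or (.alwLe k (ψ.barAux false))
        (.untlLe k (ψ.barAux false) (.and (φ.barAux false) (ψ.barAux false)))
  | true, .evLe k φ => .evLe k (φ.barAux true)
  | false, .evLe k φ => .alwLe k (φ.barAux false)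
  | true, .alwLe k φ => .alwLe k (φ.barAux true)
  | false, .alwLe k φ => .evLe k (φ.barAux false)

/-- A specification: a co-safe or a bounded formula. -/
inductive Spec (Υ : Type*) where
  | cs (φ : CsLTL Υ)
  | bounded (φ : BLTL Υ)

/-- Satisfaction of a specification by an infinite trace. -/
def Spec.Sat {Υ : Type*} : Spec Υ → (ℕ → Set Υ) → Prop
  | .cs φ, ξ => φ.Sat ξ
  | .bounded φ, ξ => φ.Sat ξ

/-- The negation-free translation of a specification. -/
def Spec.bar {Υ : Type*} : Spec Υ → PosLTL (Υ ⊕ Υ)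
  | .cs φ => φ.bar
  | .bounded φ => φ.barAux true

/-- A finite trace is a good prefix of `φ` if each of its infinite extensions satisfies `φ`. -/
def Spec.IsGoodPrefix {Υ : Type*} (φ : Spec Υ) (w : List (Set Υ)) : Prop :=
  ∀ ξ : ℕ → Set Υ, φ.Sat (appendTrace w ξ)

/-- The set of literals that hold at a position with label set `S`: `Sum.inl p` for `p ∈ S`,
`Sum.inr p` for `p ∉ S`. -/
def litSet {Υ : Type*} (S : Set Υ) : Set (Υ ⊕ Υ) := Sum.inl '' S ∪ Sum.inr '' Sᶜ

/-- A finite word of label sets over the doubled propositions is a good prefix of the translated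
formula if it satisfies it whatever infinite trace over the original propositions follows. The word
itself may be incomplete (neither `p` nor `¬ p`) or ambiguous (both). -/
def Spec.IsGoodPrefixBar {Υ : Type*} (φ : Spec Υ) (w : List (Set (Υ ⊕ Υ))) : Prop :=
  ∀ ξ : ℕ → Set Υ, φ.bar.Sat (appendTrace w (fun n => litSet (ξ n)))

/-! ## Linear stochastic hybrid systems -/

/-- A discrete-time linear stochastic hybrid system with modes `A`, continuous state space `ℝ^m`,
noise of dimension `r` and atomic propositions `Υ`, each given by its region. -/
structure SHS (A Υ : Type*) (m r : ℕ) where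
  /-- drift terms -/
  F : A → Matrix (Fin m) (Fin m) ℝ
  /-- diffusion terms -/
  G : A → Matrix (Fin m) (Fin r) ℝ
  /-- covariance matrix of the noise -/
  cov : Matrix (Fin r) (Fin r) ℝ
  cov_posSemidef : cov.PosSemidef
  /-- the region of interest of each proposition -/
  region : Υ → Set (EuclideanSpace ℝ (Fin m))

section System

variable {A Υ : Type*} {m r : ℕ}

/-- The labelling function of the system. -/
def SHS.label (H : SHS A Υ m r) (s : A × EuclideanSpace ℝ (Fin m)) : Set Υ :=
  {p | s.2 ∈ H.region p}

/-- One step of the dynamics: `F(a) x + G(a) w`. -/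
noncomputable def SHS.next (H : SHS A Υ m r)
    (p : (A × EuclideanSpace ℝ (Fin m)) × EuclideanSpace ℝ (Fin r)) : EuclideanSpace ℝ (Fin m) :=
  (H.F p.1.1).toEuclideanLin p.1.2 + (H.G p.1.1).toEuclideanLin p.2

variable [Finite A] [MeasurableSpace A] [DiscreteMeasurableSpace A]

theorem SHS.measurable_next (H : SHS A Υ m r) : Measurable H.next := by
  have h : ∀ a, Measurable fun q : EuclideanSpace ℝ (Fin m) × EuclideanSpace ℝ (Fin r) =>
      (H.F a).toEuclideanLin q.1 + (H.G a).toEuclideanLin q.2 := fun a =>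
    (((H.F a).toEuclideanLin.continuous_of_finiteDimensional.comp continuous_fst).add
      ((H.G a).toEuclideanLin.continuous_of_finiteDimensional.comp continuous_snd)).measurable
  have h' : Measurable fun q : A × (EuclideanSpace ℝ (Fin m) × EuclideanSpace ℝ (Fin r)) =>
      (H.F q.1).toEuclideanLin q.2.1 + (H.G q.1).toEuclideanLin q.2.2 :=
    measurable_from_prod_countable_right h
  have e : Measurable fun p : (A × EuclideanSpace ℝ (Fin m)) × EuclideanSpace ℝ (Fin r) =>
      (p.1.1, (p.1.2, p.2)) :=
    (measurable_fst.comp measurable_fst).prodMk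
      ((measurable_snd.comp measurable_fst).prodMk measurable_snd)
  have h'' := h'.comp e
  exact h''

/-- The transition kernel: `T(· | x, a)` is the law of `F(a) x + G(a) w`, where `w` is a centred
Gaussian vector with covariance matrix `cov`. -/
noncomputable def SHS.T (H : SHS A Υ m r) :
    Kernel (A × EuclideanSpace ℝ (Fin m)) (EuclideanSpace ℝ (Fin m)) where
  toFun p := (multivariateGaussian 0 H.cov).map (fun w => H.next (p, w))
  measurable' := by
    have h : (fun p : A × EuclideanSpace ℝ (Fin m) =>
        (multivariateGaussian 0 H.cov).map (fun w => H.next (p, w))) =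
        fun p => ((multivariateGaussian 0 H.cov).map (Prod.mk p)).map H.next := by
      funext p
      rw [Measure.map_map H.measurable_next measurable_prodMk_left]
      rfl
    rw [h]
    exact (Measure.measurable_map _ H.measurable_next).comp Measurable.map_prodMk_left

instance (H : SHS A Υ m r) : IsMarkovKernel H.T :=
  ⟨fun _ => Measure.isProbabilityMeasure_map
    (H.measurable_next.comp measurable_prodMk_left).aemeasurable⟩

/-- A (measurable) switching strategy: it maps each finite path `s₀ … sₙ` to a mode. -/
structure SwitchingStrategy (A : Type*) [MeasurableSpace A] (m : ℕ) where
  act : (n : ℕ) → (Finset.Iic n → A × EuclideanSpace ℝ (Fin m)) → A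
  measurable_act : ∀ n, Measurable (act n)

/-- The law of the next hybrid state given the path `h = s₀ … sₙ`: the strategy chooses the mode
`a`, the continuous state moves according to `T(· | xₙ, a)`, and the new mode is `a`. -/
noncomputable def SHS.stepKernel (H : SHS A Υ m r) (σ : SwitchingStrategy A m) (n : ℕ) :
    Kernel (Finset.Iic n → A × EuclideanSpace ℝ (Fin m)) (A × EuclideanSpace ℝ (Fin m)) :=
  (Kernel.deterministic Prod.fst measurable_fst ×ₖ H.T).comap
    (fun h => (σ.act n h, (h ⟨n, Finset.mem_Iic.2 le_rfl⟩).2))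
    ((σ.measurable_act n).prodMk (measurable_snd.comp (measurable_pi_apply _)))

instance (H : SHS A Υ m r) (σ : SwitchingStrategy A m) (n : ℕ) :
    IsMarkovKernel (H.stepKernel σ n) := by
  unfold SHS.stepKernel; infer_instance

/-- The law of the infinite path from `s₀` under the strategy `σ` (Ionescu-Tulcea). -/
noncomputable def SHS.pathMeasure (H : SHS A Υ m r) (σ : SwitchingStrategy A m)
    (s₀ : A × EuclideanSpace ℝ (Fin m)) : Measure (ℕ → A × EuclideanSpace ℝ (Fin m)) :=
  Kernel.traj (X := fun _ => A × EuclideanSpace ℝ (Fin m)) (H.stepKernel σ) 0 (fun _ => s₀)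

/-- The paths some finite prefix `s₀ … s_k` of which stays in `A × X` and has a trace that is a good
prefix of `φ`. -/
def SHS.satEvent (H : SHS A Υ m r) (X : Set (EuclideanSpace ℝ (Fin m))) (φ : Spec Υ) :
    Set (ℕ → A × EuclideanSpace ℝ (Fin m)) :=
  {ω | ∃ k, (∀ i ≤ k, (ω i).2 ∈ X) ∧
    φ.IsGoodPrefix (List.ofFn fun i : Fin (k + 1) => H.label (ω i))}

/-- `P(φ | s₀, X, σ)`. -/
noncomputable def SHS.satProb (H : SHS A Υ m r) (X : Set (EuclideanSpace ℝ (Fin m))) (φ : Spec Υ)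
    (σ : SwitchingStrategy A m) (s₀ : A × EuclideanSpace ℝ (Fin m)) : ℝ :=
  (H.pathMeasure σ s₀).real (H.satEvent X φ)

end System

/-! ## Interval Markov decision processes -/

/-- The lower and upper transition probabilities of an interval Markov decision process. -/
structure IMDP (Q A : Type*) where
  lower : Q → A → Q → ℝ
  upper : Q → A → Q → ℝ

section IMDP

variable {Q A M : Type*}

/-- The product with a deterministic memory that is updated by the state that is entered. -/
noncomputable def IMDP.prod (I : IMDP Q A) (δ : M → Q → M) : IMDP (Q × M) A where
  lower s a s' := open Classical in if s'.2 = δ s.2 s'.1 then I.lower s.1 a s'.1 else 0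
  upper s a s' := open Classical in if s'.2 = δ s.2 s'.1 then I.upper s.1 a s'.1 else 0

variable [Fintype Q]

/-- Feasible distributions. -/
def IMDP.feasible (I : IMDP Q A) (q : Q) (a : A) : Set (Q → ℝ) :=
  {γ | γ ∈ stdSimplex ℝ Q ∧ ∀ q', I.lower q a q' ≤ γ q' ∧ γ q' ≤ I.upper q a q'}

/-- The least expectation of `V` after one step, over the feasible distributions. -/
noncomputable def IMDP.minExp (I : IMDP Q A) (V : Q → ℝ) (q : Q) (a : A) : ℝ :=
  sInf ((fun γ : Q → ℝ => ∑ q', γ q' * V q') '' I.feasible q a)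

/-- The greatest expectation of `V` after one step, over the feasible distributions. -/
noncomputable def IMDP.maxExp (I : IMDP Q A) (V : Q → ℝ) (q : Q) (a : A) : ℝ :=
  sSup ((fun γ : Q → ℝ => ∑ q', γ q' * V q') '' I.feasible q a)

open Classical in
/-- Recursive evaluation of a Bellman equation with value `1` on `acc` and right-hand side `B`
elsewhere, started from `0` off `acc`. -/
noncomputable def bellmanIter (acc : Set Q) (B : (Q → ℝ) → Q → ℝ) : ℕ → Q → ℝ
  | 0 => fun q => if q ∈ acc then 1 else 0
  | n + 1 => fun q => if q ∈ acc then 1 else B (bellmanIter acc B n) q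

/-- The value of the Bellman equation: the limit of its (nondecreasing) recursive evaluations. -/
noncomputable def bellmanValue (acc : Set Q) (B : (Q → ℝ) → Q → ℝ) (q : Q) : ℝ :=
  ⨆ n, bellmanIter acc B n q

/-- Optimal lower bound: maximize over actions, minimize over feasible distributions. -/
noncomputable def IMDP.optLowerValue (I : IMDP Q A) (acc : Set Q) : Q → ℝ :=
  bellmanValue acc fun V q => ⨆ a, I.minExp V q a

/-- Lower bound on the probability of reaching `acc` under the stationary strategy `σ`. -/
noncomputable def IMDP.lowerValue (I : IMDP Q A) (acc : Set Q) (σ : Q → A) : Q → ℝ :=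
  bellmanValue acc fun V q => I.minExp V q (σ q)

/-- Upper bound on the probability of reaching `acc` under the stationary strategy `σ`. -/
noncomputable def IMDP.upperValue (I : IMDP Q A) (acc : Set Q) (σ : Q → A) : Q → ℝ :=
  bellmanValue acc fun V q => I.maxExp V q (σ q)

/-- `σ` is a stationary strategy that attains the optimal lower bound at every state. -/
def IMDP.IsOptimal (I : IMDP Q A) (acc : Set Q) (σ : Q → A) : Prop :=
  ∀ q, I.lowerValue acc σ q = I.optLowerValue acc q

end IMDP

/-! ## The abstraction -/

/-- A discretization of `A × X`: for each mode `a`, the set `X` is the union of finitely many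
full-dimensional polytopes that overlap in Lebesgue null sets only. -/
structure Discretization {A : Type*} {m : ℕ} (X : Set (EuclideanSpace ℝ (Fin m)))
    (Cell : A → Type*) where
  cell : (a : A) → Cell a → Set (EuclideanSpace ℝ (Fin m))
  polytope : ∀ a c, ∃ V : Finset (EuclideanSpace ℝ (Fin m)), cell a c = convexHull ℝ (V : Set _)
  fullDim : ∀ a c, (interior (cell a c)).Nonempty
  cover : ∀ a, ⋃ c, cell a c = X
  overlap : ∀ a c c', c ≠ c' → volume (cell a c ∩ cell a c') = 0

/-- States of the abstraction: the cells of all modes, and `none` for the complement of `A × X`. -/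
abbrev AbsState {A : Type*} (Cell : A → Type*) := Option (Σ a, Cell a)

section Abstraction

variable {A Υ : Type*} {m r : ℕ} {X : Set (EuclideanSpace ℝ (Fin m))} {Cell : A → Type*}

/-- The literal `Sum.inl p` has the region of `p`, the literal `Sum.inr p` its complement in `X`. -/
def SHS.litRegion (H : SHS A Υ m r) (X : Set (EuclideanSpace ℝ (Fin m))) :
    Υ ⊕ Υ → Set (EuclideanSpace ℝ (Fin m))
  | .inl p => H.region p
  | .inr p => X \ H.region p

/-- The under-approximating labelling: the literals whose region contains the cell. -/
def Discretization.labelUnder (D : Discretization X Cell) (H : SHS A Υ m r) :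
    AbsState Cell → Set (Υ ⊕ Υ)
  | some i => {p | D.cell i.1 i.2 ⊆ H.litRegion X p}
  | none => ∅

/-- The over-approximating labelling: the literals whose region meets the cell. -/
def Discretization.labelOver (D : Discretization X Cell) (H : SHS A Υ m r) :
    AbsState Cell → Set (Υ ⊕ Υ)
  | some i => {p | (D.cell i.1 i.2 ∩ H.litRegion X p).Nonempty}
  | none => ∅

variable [Fintype A] [MeasurableSpace A] [DiscreteMeasurableSpace A]

open Classical in
/-- The abstraction of the system: action `a` leads into cells of mode `a` or out of `A × X`, with
the extremal probabilities over the points of the current cell; the outside is absorbing. -/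
noncomputable def Discretization.imdp (D : Discretization X Cell) (H : SHS A Υ m r) :
    IMDP (AbsState Cell) A where
  lower
    | some i, a, some j =>
        if j.1 = a then ⨅ x : D.cell i.1 i.2, (H.T (a, (x : EuclideanSpace ℝ (Fin m)))).real
          (D.cell j.1 j.2) else 0
    | some i, a, none =>
        1 - ⨆ x : D.cell i.1 i.2, (H.T (a, (x : EuclideanSpace ℝ (Fin m)))).real X
    | none, _, some _ => 0
    | none, _, none => 1
  upper
    | some i, a, some j =>
        if j.1 = a then ⨆ x : D.cell i.1 i.2, (H.T (a, (x : EuclideanSpace ℝ (Fin m)))).real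
          (D.cell j.1 j.2) else 0
    | some i, a, none =>
        1 - ⨅ x : D.cell i.1 i.2, (H.T (a, (x : EuclideanSpace ℝ (Fin m)))).real X
    | none, _, some _ => 0
    | none, _, none => 1

/-- A measurable assignment of hybrid states to abstract states: `(a, x)` with `x ∈ X` goes to a
cell of mode `a` that contains `x` (on common boundaries one of them is selected), and `(a, x)`
with `x ∉ X` goes to `none`. -/
structure Quantizer (D : Discretization X Cell) where
  abs : A × EuclideanSpace ℝ (Fin m) → AbsState Cell
  inside : ∀ a, ∀ x ∈ X, ∃ c : Cell a, abs (a, x) = some ⟨a, c⟩ ∧ x ∈ D.cell a c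
  outside : ∀ a, ∀ x ∉ X, abs (a, x) = none
  measurableSet_fiber : ∀ q, MeasurableSet (abs ⁻¹' {q})

/-- The switching strategy to which a strategy `σ` on the product of the abstraction (labelled by
`L`) and the automaton `𝒜` is refined: on the path `s₀ … sₙ` with abstract states `q₀ … qₙ` the
mode is `σ (qₙ, z)`, where `z` is the state of `𝒜` after it has read `L q₀ … L qₙ`. -/
def Quantizer.refine {α Z : Type*} [∀ a, Finite (Cell a)] {D : Discretization X Cell}
    (κ : Quantizer D) (L : AbsState Cell → Set α) (𝒜 : DFA (Set α) Z)
    (σ : AbsState Cell × Z → A) : SwitchingStrategy A m where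
  act n h := σ (κ.abs (h ⟨n, Finset.mem_Iic.2 le_rfl⟩),
    𝒜.eval (List.ofFn fun i : Fin (n + 1) =>
      L (κ.abs (h ⟨i, Finset.mem_Iic.2 (Nat.lt_succ_iff.1 i.2)⟩))))
  measurable_act n := by
    let _ : MeasurableSpace (AbsState Cell) := ⊤
    have hκ : Measurable κ.abs := measurable_to_countable' κ.measurableSet_fiber
    have h1 : Measurable fun (h : Finset.Iic n → A × EuclideanSpace ℝ (Fin m)) i =>
        κ.abs (h i) := measurable_pi_lambda _ fun i => hκ.comp (measurable_pi_apply i)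
    have h2 : Measurable fun g : Finset.Iic n → AbsState Cell =>
        σ (g ⟨n, Finset.mem_Iic.2 le_rfl⟩, 𝒜.eval (List.ofFn fun i : Fin (n + 1) =>
          L (g ⟨i, Finset.mem_Iic.2 (Nat.lt_succ_iff.1 i.2)⟩))) := Measurable.of_discrete
    exact h2.comp h1

variable [∀ a, Fintype (Cell a)] {Z : Type*}

/-- The product of the abstraction with the labelling `labelUnder` and the automaton. -/
noncomputable def Discretization.productUnder (D : Discretization X Cell) (H : SHS A Υ m r)
    (𝒜 : DFA (Set (Υ ⊕ Υ)) Z) : IMDP (AbsState Cell × Z) A :=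
  (D.imdp H).prod fun z q => 𝒜.step z (D.labelUnder H q)

/-- The product of the abstraction with the labelling `labelOver` and the automaton (second copy of
`Z`), which also carries, as the memory of a strategy that was computed on `productUnder`, the run
of the automaton on the labels `labelUnder` (first copy of `Z`). -/
noncomputable def Discretization.productOver (D : Discretization X Cell) (H : SHS A Υ m r)
    (𝒜 : DFA (Set (Υ ⊕ Υ)) Z) : IMDP (AbsState Cell × Z × Z) A :=
  (D.imdp H).prod fun z q => (𝒜.step z.1 (D.labelUnder H q), 𝒜.step z.2 (D.labelOver H q))

/-- The accepting states of `productUnder`. -/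
def accUnder (Cell : A → Type*) {α : Type*} (𝒜 : DFA α Z) : Set (AbsState Cell × Z) :=
  {s | s.2 ∈ 𝒜.accept}

/-- The accepting states of `productOver`. -/
def accOver (Cell : A → Type*) {α : Type*} (𝒜 : DFA α Z) : Set (AbsState Cell × Z × Z) :=
  {s | s.2.2 ∈ 𝒜.accept}

variable [Fintype Z]

/-- The optimal lower bound for the formula from the abstract state `q`, by the labelling
`labelUnder`; the automaton has read the label of `q`. -/
noncomputable def Discretization.lowerBound (D : Discretization X Cell) (H : SHS A Υ m r)
    (𝒜 : DFA (Set (Υ ⊕ Υ)) Z) (q : AbsState Cell) : ℝ :=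
  (D.productUnder H 𝒜).optLowerValue (accUnder Cell 𝒜) (q, 𝒜.step 𝒜.start (D.labelUnder H q))

/-- The upper bound for the formula from the abstract state `q` under the strategy `σ`, by the
labelling `labelOver`; the automaton has read the label of `q`. -/
noncomputable def Discretization.upperBound (D : Discretization X Cell) (H : SHS A Υ m r)
    (𝒜 : DFA (Set (Υ ⊕ Υ)) Z) (σ : AbsState Cell × Z → A) (q : AbsState Cell) : ℝ :=
  (D.productOver H 𝒜).upperValue (accOver Cell 𝒜) (fun s => σ (s.1, s.2.1))
    (q, 𝒜.step 𝒜.start (D.labelUnder H q), 𝒜.step 𝒜.start (D.labelOver H q))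

end Abstraction

/-!
Reading `¬ p` as a new proposition makes the translated formula monotone in the labels, so a run of
the automaton on under-approximating labels accepts only if the trace is a good prefix, and a run on
over-approximating labels accepts whenever it is. Both bounds on the probability of satisfaction
thereby become bounds on the probability that a product of the abstraction with a memory reaches an
accepting state while the path stays in `A × X`.

A nondegenerate Gaussian law charges no convex Lebesgue null set, hence no overlap of two cells.
The law of the next cell is therefore one of the feasible distributions, and the `n`-th recursive
evaluation of the Bellman equation bounds the probability of reaching an accepting state within `n`
steps, by induction on `n` with the Markov property at the first step.

The abstraction may go on after the path has left `A × X`, where the memory only reads `∅`. This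
raises the upper value only; it leaves the lower value unchanged because a word that becomes a good
prefix when `∅` is appended already is one, by monotonicity.
-/

/-! ## Good prefixes -/

section GoodPrefix

theorem PosLTL.Sat.mono {α : Type*} {φ : PosLTL α} {ξ ξ' : ℕ → Set α} (h : φ.Sat ξ)
    (hξ : ∀ n, ξ n ⊆ ξ' n) : φ.Sat ξ' := by
  have suffix_subset {ξ ξ' : ℕ → Set α} (hξ : ∀ n, ξ n ⊆ ξ' n) (k n : ℕ) :
      traceSuffix ξ k n ⊆ traceSuffix ξ' k n := hξ (k + n)
  induction φ generalizing ξ ξ' with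
  | atom p => exact hξ 0 h
  | or φ ψ ihφ ihψ => exact h.imp (ihφ · hξ) (ihψ · hξ)
  | and φ ψ ihφ ihψ => exact ⟨ihφ h.1 hξ, ihψ h.2 hξ⟩
  | next φ ih => exact ih h (suffix_subset hξ 1)
  | untl φ ψ ihφ ihψ =>
    obtain ⟨k, hψ, hφ⟩ := h
    exact ⟨k, ihψ hψ (suffix_subset hξ k), fun i hi => ihφ (hφ i hi) (suffix_subset hξ i)⟩
  | ev φ ih =>
    obtain ⟨k, hφ⟩ := h
    exact ⟨k, ih hφ (suffix_subset hξ k)⟩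
  | untlLe k φ ψ ihφ ihψ =>
    obtain ⟨j, hjk, hψ, hφ⟩ := h
    exact ⟨j, hjk, ihψ hψ (suffix_subset hξ j), fun i hi => ihφ (hφ i hi) (suffix_subset hξ i)⟩
  | evLe k φ ih =>
    obtain ⟨j, hjk, hφ⟩ := h
    exact ⟨j, hjk, ih hφ (suffix_subset hξ j)⟩
  | alwLe k φ ih => exact fun j hj => ih (h j hj) (suffix_subset hξ j)

variable {Υ : Type*}

theorem inl_mem_litSet {S : Set Υ} {p : Υ} : Sum.inl p ∈ litSet S ↔ p ∈ S := by
  simp [litSet]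

theorem inr_mem_litSet {S : Set Υ} {p : Υ} : Sum.inr p ∈ litSet S ↔ p ∉ S := by
  simp [litSet]

theorem traceSuffix_litSet (ξ : ℕ → Set Υ) (k : ℕ) :
    traceSuffix (fun n => litSet (ξ n)) k = fun n => litSet (traceSuffix ξ k n) := rfl

theorem CsLTL.sat_bar (φ : CsLTL Υ) (ξ : ℕ → Set Υ) :
    φ.bar.Sat (fun n => litSet (ξ n)) ↔ φ.Sat ξ := by
  induction φ generalizing ξ with
  | atom p => exact inl_mem_litSet
  | negAtom p => exact inr_mem_litSet
  | or φ ψ ihφ ihψ => simp only [bar, Sat, PosLTL.Sat, ihφ, ihψ]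
  | and φ ψ ihφ ihψ => simp only [bar, Sat, PosLTL.Sat, ihφ, ihψ]
  | next φ ih => simp only [bar, Sat, PosLTL.Sat, traceSuffix_litSet, ih]
  | untl φ ψ ihφ ihψ => simp only [bar, Sat, PosLTL.Sat, traceSuffix_litSet, ihφ, ihψ]
  | ev φ ih => simp only [bar, Sat, PosLTL.Sat, traceSuffix_litSet, ih]

theorem not_exists_le_and_forall_lt_iff (k : ℕ) (P R : ℕ → Prop) :
    (¬ ∃ j ≤ k, R j ∧ ∀ i < j, P i) ↔
      (∀ j ≤ k, ¬ R j) ∨ ∃ j ≤ k, (¬ P j ∧ ¬ R j) ∧ ∀ i < j, ¬ R i := by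
  constructor
  · intro h
    rw [or_iff_not_imp_left]
    intro hR
    push Not at hR
    classical
    obtain ⟨j, ⟨hjk, hRj⟩, hmin⟩ := Nat.findX hR
    have not_R {i : ℕ} (hi : i < j) : ¬ R i := fun hRi => hmin i hi ⟨hi.le.trans hjk, hRi⟩
    obtain ⟨i, hij, hPi⟩ : ∃ i < j, ¬ P i := by
      by_contra! hP
      exact h ⟨j, hjk, hRj, hP⟩
    exact ⟨i, hij.le.trans hjk, ⟨hPi, not_R hij⟩, fun l hl => not_R (hl.trans hij)⟩
  · rintro (hR | ⟨i, -, ⟨hPi, hRi⟩, hR⟩) ⟨j, hjk, hRj, hP⟩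
    · exact hR j hjk hRj
    · rcases lt_trichotomy i j with hij | rfl | hji
      · exact hPi (hP i hij)
      · exact hRi hRj
      · exact hR j hji hRj

theorem BLTL.sat_barAux (φ : BLTL Υ) (ξ : ℕ → Set Υ) :
    ((φ.barAux true).Sat (fun n => litSet (ξ n)) ↔ φ.Sat ξ) ∧
      ((φ.barAux false).Sat (fun n => litSet (ξ n)) ↔ ¬ φ.Sat ξ) := by
  induction φ generalizing ξ with
  | atom p => exact ⟨inl_mem_litSet, inr_mem_litSet⟩
  | neg φ ih => simp only [barAux, Sat, ih, not_not, and_self]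
  | or φ ψ ihφ ihψ => simp only [barAux, Sat, PosLTL.Sat, ihφ, ihψ, not_or, and_self]
  | next φ ih => simp only [barAux, Sat, PosLTL.Sat, traceSuffix_litSet, ih, and_self]
  | untlLe k φ ψ ihφ ihψ =>
    simp only [barAux, Sat, PosLTL.Sat, traceSuffix_litSet, ihφ, ihψ,
      not_exists_le_and_forall_lt_iff, and_self]
  | evLe k φ ih =>
    simp only [barAux, Sat, PosLTL.Sat, traceSuffix_litSet, ih, not_exists, not_and, and_self]
  | alwLe k φ ih =>
    simp only [barAux, Sat, PosLTL.Sat, traceSuffix_litSet, ih, not_forall, exists_prop, and_self]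

theorem Spec.sat_bar (φ : Spec Υ) (ξ : ℕ → Set Υ) :
    φ.bar.Sat (fun n => litSet (ξ n)) ↔ φ.Sat ξ := by
  cases φ with
  | cs φ => exact φ.sat_bar ξ
  | bounded φ => exact (φ.sat_barAux ξ).1

theorem appendTrace_map {α β : Type*} (f : α → β) (w : List α) (ξ : ℕ → α) :
    appendTrace (w.map f) (fun n => f (ξ n)) = fun n => f (appendTrace w ξ n) := by
  funext n
  by_cases hn : n < w.length <;> simp [appendTrace, hn]

theorem Spec.isGoodPrefixBar_map_litSet (φ : Spec Υ) (w : List (Set Υ)) :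
    φ.IsGoodPrefixBar (w.map litSet) ↔ φ.IsGoodPrefix w := by
  simp only [Spec.IsGoodPrefixBar, Spec.IsGoodPrefix, appendTrace_map, φ.sat_bar]

theorem Spec.IsGoodPrefixBar.mono {φ : Spec Υ} {w w' : List (Set (Υ ⊕ Υ))}
    (h : φ.IsGoodPrefixBar w) (hw : List.Forall₂ (· ⊆ ·) w w') : φ.IsGoodPrefixBar w' := by
  intro ξ
  refine (h ξ).mono fun n => ?_
  have hlen := hw.length_eq
  by_cases hn : n < w.length
  · simpa [appendTrace, hn, hlen ▸ hn] using hw.get hn (hlen ▸ hn)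
  · simp [appendTrace, hlen ▸ hn, hlen]

theorem Spec.IsGoodPrefixBar.of_append_empty {φ : Spec Υ} {w : List (Set (Υ ⊕ Υ))}
    (h : φ.IsGoodPrefixBar (w ++ [∅])) : φ.IsGoodPrefixBar w := by
  intro ξ
  refine (h (traceSuffix ξ 1)).mono fun n => ?_
  rcases lt_trichotomy n w.length with hn | rfl | hn
  · simp [appendTrace, hn, Nat.lt_succ_of_lt hn]
  · simp [appendTrace]
  · have hn' : ¬ n < w.length + 1 := by omega
    have hshift : 1 + (n - (w.length + 1)) = n - w.length := by omega
    simp [appendTrace, traceSuffix, hn.not_gt, hn', hshift]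

end GoodPrefix

/-! ## Bellman iterations of interval Markov decision processes -/

section BellmanIteration

variable {Q A M : Type*}

theorem bellmanIter_of_mem {acc : Set Q} {B : (Q → ℝ) → Q → ℝ} {q : Q} (hq : q ∈ acc) (n : ℕ) :
    bellmanIter acc B n q = 1 := by
  cases n <;> simp [bellmanIter, hq]

theorem bellmanIter_zero_of_notMem {acc : Set Q} {B : (Q → ℝ) → Q → ℝ} {q : Q} (hq : q ∉ acc) :
    bellmanIter acc B 0 q = 0 := by
  simp [bellmanIter, hq]

theorem bellmanIter_succ_of_notMem {acc : Set Q} {B : (Q → ℝ) → Q → ℝ} {q : Q} (hq : q ∉ acc)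
    (n : ℕ) : bellmanIter acc B (n + 1) q = B (bellmanIter acc B n) q := by
  simp [bellmanIter, hq]

theorem bellmanIter_mem_Icc {acc : Set Q} {B : (Q → ℝ) → Q → ℝ}
    (hB : ∀ V, (∀ q, V q ∈ Set.Icc (0 : ℝ) 1) → ∀ q, B V q ∈ Set.Icc (0 : ℝ) 1) (n : ℕ) (q : Q) :
    bellmanIter acc B n q ∈ Set.Icc (0 : ℝ) 1 := by
  induction n generalizing q with
  | zero => by_cases hq : q ∈ acc <;> simp [bellmanIter, hq]
  | succ n ih => by_cases hq : q ∈ acc <;> simp [bellmanIter, hq, Set.mem_Icc.1 (hB _ ih q)]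

variable [Fintype Q] (I : IMDP Q A)

namespace IMDP

theorem image_feasible_subset_Icc {V : Q → ℝ} (hV : ∀ q, V q ∈ Set.Icc (0 : ℝ) 1) (q : Q) (a : A) :
    (fun γ : Q → ℝ => ∑ q', γ q' * V q') '' I.feasible q a ⊆ Set.Icc 0 1 := by
  rintro _ ⟨γ, ⟨⟨hγ₀, hγ₁⟩, -⟩, rfl⟩
  refine ⟨Finset.sum_nonneg fun q' _ => mul_nonneg (hγ₀ q') (hV q').1, ?_⟩
  calc ∑ q', γ q' * V q' ≤ ∑ q', γ q' :=
        Finset.sum_le_sum fun q' _ => mul_le_of_le_one_right (hγ₀ q') (hV q').2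
    _ = 1 := hγ₁

theorem minExp_mem_Icc {V : Q → ℝ} (hV : ∀ q, V q ∈ Set.Icc (0 : ℝ) 1) (q : Q) (a : A) :
    I.minExp V q a ∈ Set.Icc (0 : ℝ) 1 := by
  have hsub := I.image_feasible_subset_Icc hV q a
  refine ⟨Real.sInf_nonneg fun x hx => (hsub hx).1, ?_⟩
  rw [minExp]
  obtain hempty | ⟨x, hx⟩ := Set.eq_empty_or_nonempty
    ((fun γ : Q → ℝ => ∑ q', γ q' * V q') '' I.feasible q a)
  · simp [hempty]
  · exact (csInf_le (bddBelow_Icc.mono hsub) hx).trans (hsub hx).2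

theorem maxExp_mem_Icc {V : Q → ℝ} (hV : ∀ q, V q ∈ Set.Icc (0 : ℝ) 1) (q : Q) (a : A) :
    I.maxExp V q a ∈ Set.Icc (0 : ℝ) 1 := by
  have hsub := I.image_feasible_subset_Icc hV q a
  exact ⟨Real.sSup_nonneg fun x hx => (hsub hx).1,
    Real.sSup_le (fun x hx => (hsub hx).2) zero_le_one⟩

theorem minExp_le {V : Q → ℝ} (hV : ∀ q, V q ∈ Set.Icc (0 : ℝ) 1) {q : Q} {a : A} {γ : Q → ℝ}
    (hγ : γ ∈ I.feasible q a) : I.minExp V q a ≤ ∑ q', γ q' * V q' :=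
  csInf_le (bddBelow_Icc.mono (I.image_feasible_subset_Icc hV q a)) ⟨γ, hγ, rfl⟩

theorem le_maxExp {V : Q → ℝ} (hV : ∀ q, V q ∈ Set.Icc (0 : ℝ) 1) {q : Q} {a : A} {γ : Q → ℝ}
    (hγ : γ ∈ I.feasible q a) : ∑ q', γ q' * V q' ≤ I.maxExp V q a :=
  le_csSup (bddAbove_Icc.mono (I.image_feasible_subset_Icc hV q a)) ⟨γ, hγ, rfl⟩

/-- The recursive evaluations of the Bellman equation of `IMDP.lowerValue`. -/
noncomputable def lowerIter (acc : Set Q) (σ : Q → A) : ℕ → Q → ℝ :=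
  bellmanIter acc fun V q => I.minExp V q (σ q)

/-- The recursive evaluations of the Bellman equation of `IMDP.upperValue`. -/
noncomputable def upperIter (acc : Set Q) (σ : Q → A) : ℕ → Q → ℝ :=
  bellmanIter acc fun V q => I.maxExp V q (σ q)

theorem lowerIter_mem_Icc (acc : Set Q) (σ : Q → A) (n : ℕ) (q : Q) :
    I.lowerIter acc σ n q ∈ Set.Icc (0 : ℝ) 1 :=
  bellmanIter_mem_Icc (fun _ hV q => I.minExp_mem_Icc hV q (σ q)) n q

theorem upperIter_mem_Icc (acc : Set Q) (σ : Q → A) (n : ℕ) (q : Q) :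
    I.upperIter acc σ n q ∈ Set.Icc (0 : ℝ) 1 :=
  bellmanIter_mem_Icc (fun _ hV q => I.maxExp_mem_Icc hV q (σ q)) n q

theorem lowerIter_zero_of_notMem {acc : Set Q} (σ : Q → A) {q : Q} (hq : q ∉ acc) :
    I.lowerIter acc σ 0 q = 0 :=
  bellmanIter_zero_of_notMem hq

theorem upperIter_of_mem {acc : Set Q} (σ : Q → A) {q : Q} (hq : q ∈ acc) (n : ℕ) :
    I.upperIter acc σ n q = 1 :=
  bellmanIter_of_mem hq n

theorem upperIter_le_upperValue (acc : Set Q) (σ : Q → A) (n : ℕ) (q : Q) :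
    I.upperIter acc σ n q ≤ I.upperValue acc σ q := by
  have bdd : BddAbove (Set.range fun n => I.upperIter acc σ n q) :=
    bddAbove_Icc.mono (Set.range_subset_iff.2 fun n => I.upperIter_mem_Icc acc σ n q)
  exact le_ciSup bdd n

section Product

variable [Fintype M]

open Classical in
theorem sum_prod_mul (δ : M → Q → M) (γ : Q → ℝ) (V : Q × M → ℝ) (z : M) :
    ∑ s : Q × M, (if s.2 = δ z s.1 then γ s.1 else 0) * V s = ∑ q, γ q * V (q, δ z q) := by
  simp [Fintype.sum_prod_type, ite_mul]

open Classical in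
theorem prod_mem_feasible (δ : M → Q → M) {q : Q} {a : A} {γ : Q → ℝ} (hγ : γ ∈ I.feasible q a)
    (z : M) :
    (fun s : Q × M => if s.2 = δ z s.1 then γ s.1 else 0) ∈ (I.prod δ).feasible (q, z) a := by
  obtain ⟨⟨hγ₀, hγ₁⟩, hbounds⟩ := hγ
  refine ⟨⟨fun s => ?_, ?_⟩, fun s => ?_⟩
  · beta_reduce
    split_ifs
    exacts [hγ₀ _, le_rfl]
  · simpa [hγ₁] using sum_prod_mul δ γ (fun _ => 1) z
  · simp only [IMDP.prod]
    split_ifs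
    exacts [hbounds _, ⟨le_rfl, le_rfl⟩]

theorem prod_minExp_le (δ : M → Q → M) {V : Q × M → ℝ} (hV : ∀ s, V s ∈ Set.Icc (0 : ℝ) 1)
    {q : Q} {a : A} {γ : Q → ℝ} (hγ : γ ∈ I.feasible q a) (z : M) :
    (I.prod δ).minExp V (q, z) a ≤ ∑ q', γ q' * V (q', δ z q') := by
  classical
  rw [← sum_prod_mul]
  exact minExp_le _ hV (I.prod_mem_feasible δ hγ z)

theorem le_prod_maxExp (δ : M → Q → M) {V : Q × M → ℝ} (hV : ∀ s, V s ∈ Set.Icc (0 : ℝ) 1)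
    {q : Q} {a : A} {γ : Q → ℝ} (hγ : γ ∈ I.feasible q a) (z : M) :
    ∑ q', γ q' * V (q', δ z q') ≤ (I.prod δ).maxExp V (q, z) a := by
  classical
  rw [← sum_prod_mul]
  exact le_maxExp _ hV (I.prod_mem_feasible δ hγ z)

theorem prod_lowerIter_succ_le (δ : M → Q → M) {acc : Set (Q × M)} {σ : Q × M → A} {s : Q × M}
    (hacc : s ∉ acc) {γ : Q → ℝ} (hγ : γ ∈ I.feasible s.1 (σ s)) (n : ℕ) :
    (I.prod δ).lowerIter acc σ (n + 1) s ≤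
      ∑ q', γ q' * (I.prod δ).lowerIter acc σ n (q', δ s.2 q') :=
  (bellmanIter_succ_of_notMem hacc n).trans_le <|
    I.prod_minExp_le δ (lowerIter_mem_Icc _ acc σ n) hγ s.2

theorem le_prod_upperIter_succ (δ : M → Q → M) {acc : Set (Q × M)} {σ : Q × M → A} {s : Q × M}
    (hacc : s ∉ acc) {γ : Q → ℝ} (hγ : γ ∈ I.feasible s.1 (σ s)) (n : ℕ) :
    ∑ q', γ q' * (I.prod δ).upperIter acc σ n (q', δ s.2 q') ≤
      (I.prod δ).upperIter acc σ (n + 1) s :=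
  (I.le_prod_maxExp δ (upperIter_mem_Icc _ acc σ n) hγ s.2).trans_eq <|
    Eq.symm <| bellmanIter_succ_of_notMem hacc n

theorem prod_lowerIter_nonpos_of_absorbing [DecidableEq Q] (δ : M → Q → M) {acc : Set (Q × M)}
    (σ : Q × M → A) {q : Q} (hq : ∀ a, Pi.single q 1 ∈ I.feasible q a) {N : Set M}
    (hacc : ∀ z ∈ N, (q, z) ∉ acc) (hδ : ∀ z ∈ N, δ z q ∈ N) (n : ℕ) {z : M} (hz : z ∈ N) :
    (I.prod δ).lowerIter acc σ n (q, z) ≤ 0 := by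
  induction n generalizing z with
  | zero => exact (lowerIter_zero_of_notMem _ σ (hacc z hz)).le
  | succ n ih =>
    calc (I.prod δ).lowerIter acc σ (n + 1) (q, z)
        ≤ ∑ q', (Pi.single q 1 : Q → ℝ) q' * (I.prod δ).lowerIter acc σ n (q', δ z q') :=
          I.prod_lowerIter_succ_le δ (hacc z hz) (hq _) n
      _ = (I.prod δ).lowerIter acc σ n (q, δ z q) := by simp [Pi.single_apply]
      _ ≤ 0 := ih (hδ z hz)

end Product

end IMDP

end BellmanIteration

/-! ## Reaching a set of histories along an Ionescu-Tulcea trajectory -/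

section Reach

open Finset Preorder

variable {X : ℕ → Type*}

/-- The trajectories that have one of the prefixes in `B` at some time in `[k, k + n]`. -/
def reachWithin (B : (k : ℕ) → Set (Π i : Iic k, X i)) (k n : ℕ) : Set (Π i, X i) :=
  ⋃ j ∈ Set.Icc k (k + n), frestrictLe j ⁻¹' B j

theorem mem_reachWithin {B : (k : ℕ) → Set (Π i : Iic k, X i)} {k n : ℕ} {ω : Π i, X i} :
    ω ∈ reachWithin B k n ↔ ∃ j ∈ Set.Icc k (k + n), frestrictLe j ω ∈ B j := by
  simp only [reachWithin, Set.mem_iUnion, Set.mem_preimage, exists_prop]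

theorem monotone_reachWithin (B : (k : ℕ) → Set (Π i : Iic k, X i)) (k : ℕ) :
    Monotone (reachWithin B k) := fun _ _ hn =>
  Set.biUnion_mono (Set.Icc_subset_Icc_right (Nat.add_le_add_left hn k)) fun _ _ => subset_rfl

theorem reachWithin_zero (B : (k : ℕ) → Set (Π i : Iic k, X i)) (k : ℕ) :
    reachWithin B k 0 = frestrictLe k ⁻¹' B k := by
  simp [reachWithin]

theorem reachWithin_succ (B : (k : ℕ) → Set (Π i : Iic k, X i)) (k n : ℕ) :
    reachWithin B k (n + 1) = frestrictLe k ⁻¹' B k ∪ reachWithin B (k + 1) n := by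
  have hIcc : Set.Icc k (k + (n + 1)) = insert k (Set.Icc (k + 1) (k + 1 + n)) := by
    ext j
    simp only [Set.mem_Icc, Set.mem_insert_iff]
    lia
  rw [reachWithin, hIcc, Set.biUnion_insert, reachWithin]

theorem preimage_frestrictLe_subset_reachWithin (B : (k : ℕ) → Set (Π i : Iic k, X i)) (k n : ℕ) :
    frestrictLe k ⁻¹' B k ⊆ reachWithin B k n :=
  reachWithin_zero B k ▸ monotone_reachWithin B k n.zero_le

variable [∀ n, MeasurableSpace (X n)]

theorem measurableSet_reachWithin {B : (k : ℕ) → Set (Π i : Iic k, X i)}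
    (hB : ∀ k, MeasurableSet (B k)) (k n : ℕ) : MeasurableSet (reachWithin B k n) :=
  .biUnion (Set.to_countable _) fun j _ => measurable_frestrictLe j (hB j)

/-- The history `x` followed by the state `s`. -/
def snocHistory {k : ℕ} (x : Π i : Iic k, X i) (s : X (k + 1)) : Π i : Iic (k + 1), X i :=
  IicProdIoc k (k + 1) (x, MeasurableEquiv.piSingleton k s)

theorem snocHistory_of_le {k : ℕ} (x : Π i : Iic k, X i) (s : X (k + 1)) {i : ℕ} (hi : i ≤ k) :
    snocHistory x s ⟨i, mem_Iic.2 (hi.trans k.le_succ)⟩ = x ⟨i, mem_Iic.2 hi⟩ := by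
  simp [snocHistory, IicProdIoc, hi]

theorem snocHistory_last {k : ℕ} (x : Π i : Iic k, X i) (s : X (k + 1)) :
    snocHistory x s ⟨k + 1, mem_Iic.2 le_rfl⟩ = s := by
  simp [snocHistory, IicProdIoc, MeasurableEquiv.piSingleton]

variable {κ : (n : ℕ) → Kernel (Π i : Iic n, X i) (X (n + 1))} [∀ n, IsMarkovKernel (κ n)]

theorem traj_preimage_frestrictLe {k : ℕ} (x : Π i : Iic k, X i) {C : Set (Π i : Iic k, X i)}
    (hC : MeasurableSet C) : Kernel.traj κ k x (frestrictLe k ⁻¹' C) = C.indicator 1 x := by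
  rw [← Measure.map_apply (measurable_frestrictLe k) hC, Kernel.traj_map_frestrictLe_apply,
    Kernel.partialTraj_self, Kernel.id_apply, Measure.dirac_apply' x hC]

theorem traj_eq_lintegral_traj_snocHistory {k : ℕ} (x : Π i : Iic k, X i) {E : Set (Π n, X n)}
    (hE : MeasurableSet E) :
    Kernel.traj κ k x E = ∫⁻ s, Kernel.traj κ (k + 1) (snocHistory x s) E ∂κ k x := by
  have measurable_coe := Kernel.measurable_coe (Kernel.traj κ (k + 1)) hE
  have measurable_comp : Measurable fun p => Kernel.traj κ (k + 1) (IicProdIoc k (k + 1) p) E :=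
    measurable_coe.comp measurable_IicProdIoc
  rw [← Kernel.traj_comp_partialTraj k.le_succ, Kernel.comp_apply' _ _ _ hE,
    Kernel.partialTraj_succ_self, Kernel.lintegral_map _ measurable_IicProdIoc _
      measurable_coe,
    Kernel.lintegral_id_prod measurable_comp,
    Kernel.map_apply _ (MeasurableEquiv.measurable _), lintegral_map_equiv]
  rfl

variable {B : (k : ℕ) → Set (Π i : Iic k, X i)} (hB : ∀ k, MeasurableSet (B k)) {k : ℕ}
  {x : Π i : Iic k, X i}
include hB

theorem traj_reachWithin_of_mem (hx : x ∈ B k) (n : ℕ) :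
    Kernel.traj κ k x (reachWithin B k n) = 1 := by
  refine le_antisymm prob_le_one ?_
  calc 1 = Kernel.traj κ k x (frestrictLe k ⁻¹' B k) := by
        rw [traj_preimage_frestrictLe x (hB k), Set.indicator_of_mem hx, Pi.one_apply]
    _ ≤ Kernel.traj κ k x (reachWithin B k n) :=
        measure_mono (preimage_frestrictLe_subset_reachWithin B k n)

theorem traj_reachWithin_zero_of_notMem (hx : x ∉ B k) :
    Kernel.traj κ k x (reachWithin B k 0) = 0 := by
  rw [reachWithin_zero, traj_preimage_frestrictLe x (hB k), Set.indicator_of_notMem hx]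

theorem traj_reachWithin_succ_of_notMem (hx : x ∉ B k) (n : ℕ) :
    Kernel.traj κ k x (reachWithin B k (n + 1)) =
      ∫⁻ s, Kernel.traj κ (k + 1) (snocHistory x s) (reachWithin B (k + 1) n) ∂κ k x := by
  have hnull : Kernel.traj κ k x (frestrictLe k ⁻¹' B k) = 0 := by
    rw [traj_preimage_frestrictLe x (hB k), Set.indicator_of_notMem hx]
  rw [reachWithin_succ,
    measure_congr (union_ae_eq_right.2 (measure_mono_null Set.sdiff_subset hnull)),
    traj_eq_lintegral_traj_snocHistory x (measurableSet_reachWithin hB (k + 1) n)]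

theorem traj_reachWithin_eq_zero {D : (k : ℕ) → Set (Π i : Iic k, X i)}
    (hDB : ∀ k, Disjoint (D k) (B k)) (hD : ∀ k, ∀ x ∈ D k, ∀ s, snocHistory x s ∈ D (k + 1))
    (n : ℕ) (hx : x ∈ D k) : Kernel.traj κ k x (reachWithin B k n) = 0 := by
  induction n generalizing k with
  | zero => exact traj_reachWithin_zero_of_notMem hB ((hDB k).notMem_of_mem_left hx)
  | succ n ih =>
    rw [traj_reachWithin_succ_of_notMem hB ((hDB k).notMem_of_mem_left hx)]
    simp only [ih (hD k x hx _), lintegral_zero]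

end Reach

/-! ## Abstraction of a stochastic process by an interval Markov decision process -/

theorem lintegral_ofReal_comp_eq_ofReal_sum {S Q : Type*} [MeasurableSpace S] [Fintype Q]
    {f : S → Q} (hf : ∀ q, MeasurableSet (f ⁻¹' {q})) (μ : Measure S) [IsFiniteMeasure μ]
    {V : Q → ℝ} (hV : ∀ q, 0 ≤ V q) :
    ∫⁻ s, ENNReal.ofReal (V (f s)) ∂μ = ENNReal.ofReal (∑ q, μ.real (f ⁻¹' {q}) * V q) := by
  let _ : MeasurableSpace Q := ⊤
  have measurable_f : Measurable f := measurable_to_countable' hf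
  rw [← lintegral_map (f := fun q => ENNReal.ofReal (V q)) .of_discrete measurable_f,
    lintegral_fintype, ENNReal.ofReal_sum_of_nonneg fun q _ => mul_nonneg measureReal_nonneg (hV q)]
  refine Finset.sum_congr rfl fun q _ => ?_
  rw [Measure.map_apply measurable_f (.singleton q), ENNReal.ofReal_mul measureReal_nonneg,
    ofReal_measureReal, mul_comm]

section Abstraction

open Finset Preorder

variable {X : ℕ → Type*} {Q M A α β : Type*}

/-- The word of the values of `g` along a history. -/
def historyTrace (g : (k : ℕ) → X k → α) {k : ℕ} (x : Π i : Iic k, X i) : List α :=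
  List.ofFn fun i : Fin (k + 1) => g i (x ⟨i, mem_Iic.2 (Nat.lt_succ_iff.1 i.2)⟩)

theorem map_historyTrace (f : α → β) (g : (k : ℕ) → X k → α) {k : ℕ}
    (x : Π i : Iic k, X i) : (historyTrace g x).map f = historyTrace (fun k s => f (g k s)) x :=
  List.map_ofFn ..

theorem forall₂_historyTrace {R : α → β → Prop} {g : (k : ℕ) → X k → α} {g' : (k : ℕ) → X k → β}
    {k : ℕ} {x : Π i : Iic k, X i}
    (h : ∀ i (hi : i ≤ k), R (g i (x ⟨i, mem_Iic.2 hi⟩)) (g' i (x ⟨i, mem_Iic.2 hi⟩))) :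
    List.Forall₂ R (historyTrace g x) (historyTrace g' x) := by
  refine List.forall₂_iff_get.2 ⟨by simp only [historyTrace, List.length_ofFn], fun i hi hi' => ?_⟩
  simp only [historyTrace, List.get_ofFn]
  exact h i (Nat.lt_succ_iff.1 (hi.trans_eq List.length_ofFn))

/-- The state of the product of an abstraction `f` with a memory after a history: the abstraction of
its last state, and the memory after it has read the abstractions of all its states. -/
def productState (f : (k : ℕ) → X k → Q) (δ : M → Q → M) (z₀ : M) {k : ℕ}
    (x : Π i : Iic k, X i) : Q × M :=
  (f k (x ⟨k, mem_Iic.2 le_rfl⟩), (historyTrace f x).foldl δ z₀)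

theorem productState_dfa_step {Z : Type*} (f : (k : ℕ) → X k → Q) (L : Q → α) (𝒜 : DFA α Z)
    {k : ℕ} (x : Π i : Iic k, X i) :
    productState f (fun z q => 𝒜.step z (L q)) 𝒜.start x =
      (f k (x ⟨k, mem_Iic.2 le_rfl⟩), 𝒜.eval (historyTrace (fun k s => L (f k s)) x)) := by
  rw [productState, DFA.eval, DFA.evalFrom, ← map_historyTrace, List.foldl_map]

theorem foldl_prodMk {M₁ M₂ : Type*} (δ₁ : M₁ → Q → M₁) (δ₂ : M₂ → Q → M₂) (l : List Q)
    (z : M₁ × M₂) : l.foldl (fun z q => (δ₁ z.1 q, δ₂ z.2 q)) z =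
      (l.foldl δ₁ z.1, l.foldl δ₂ z.2) := by
  induction l generalizing z with
  | nil => rfl
  | cons q _ ih => exact ih _

theorem productState_prodMk {M₁ M₂ : Type*} (f : (k : ℕ) → X k → Q) (δ₁ : M₁ → Q → M₁)
    (δ₂ : M₂ → Q → M₂) (z₁ : M₁) (z₂ : M₂) {k : ℕ} (x : Π i : Iic k, X i) :
    productState f (fun z q => (δ₁ z.1 q, δ₂ z.2 q)) (z₁, z₂) x =
      (f k (x ⟨k, mem_Iic.2 le_rfl⟩), (productState f δ₁ z₁ x).2, (productState f δ₂ z₂ x).2) := by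
  rw [productState, foldl_prodMk]
  rfl

theorem productState_dfa_step_prodMk {Z : Type*} (f : (k : ℕ) → X k → Q) (L L' : Q → α)
    (𝒜 : DFA α Z) {k : ℕ} (x : Π i : Iic k, X i) :
    productState f (fun z q => (𝒜.step z.1 (L q), 𝒜.step z.2 (L' q))) (𝒜.start, 𝒜.start) x =
      (f k (x ⟨k, mem_Iic.2 le_rfl⟩), 𝒜.eval (historyTrace (fun k s => L (f k s)) x),
        𝒜.eval (historyTrace (fun k s => L' (f k s)) x)) := by
  rw [productState_prodMk f (fun z q => 𝒜.step z (L q)) (fun z q => 𝒜.step z (L' q)),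
    productState_dfa_step, productState_dfa_step]

/-- The histories that stay in states with abstraction in `live` and end in a product state in
`acc`. -/
def targetHistories (f : (k : ℕ) → X k → Q) (δ : M → Q → M) (z₀ : M) (live : Set Q)
    (acc : Set (Q × M)) (k : ℕ) : Set (Π i : Iic k, X i) :=
  {x | (∀ i (hi : i ≤ k), f i (x ⟨i, mem_Iic.2 hi⟩) ∈ live) ∧ productState f δ z₀ x ∈ acc}

variable [∀ k, MeasurableSpace (X k)]

theorem historyTrace_snocHistory (g : (k : ℕ) → X k → α) {k : ℕ} (x : Π i : Iic k, X i)
    (s : X (k + 1)) : historyTrace g (snocHistory x s) = historyTrace g x ++ [g (k + 1) s] := by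
  rw [historyTrace, List.ofFn_succ', List.concat_eq_append, historyTrace]
  congr
  · funext i
    exact congrArg (g _) (snocHistory_of_le x s (Nat.lt_succ_iff.1 i.2))
  · exact snocHistory_last x s

theorem productState_snocHistory (f : (k : ℕ) → X k → Q) (δ : M → Q → M) (z₀ : M) {k : ℕ}
    (x : Π i : Iic k, X i) (s : X (k + 1)) : productState f δ z₀ (snocHistory x s) =
      (f (k + 1) s, δ (productState f δ z₀ x).2 (f (k + 1) s)) := by
  simp only [productState, historyTrace_snocHistory, snocHistory_last, List.foldl_append,
    List.foldl_cons, List.foldl_nil]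

theorem forall_snocHistory_mem_iff {f : (k : ℕ) → X k → Q} {live : Set Q} {k : ℕ}
    {x : Π i : Iic k, X i} {s : X (k + 1)} :
    (∀ i (hi : i ≤ k + 1), f i (snocHistory x s ⟨i, mem_Iic.2 hi⟩) ∈ live) ↔
      (∀ i (hi : i ≤ k), f i (x ⟨i, mem_Iic.2 hi⟩) ∈ live) ∧ f (k + 1) s ∈ live := by
  constructor
  · refine fun h => ⟨fun i hi => ?_, ?_⟩
    · exact snocHistory_of_le x s hi ▸ h i (hi.trans k.le_succ)
    · exact snocHistory_last x s ▸ h (k + 1) le_rfl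
  · rintro ⟨hx, hs⟩ i hi
    obtain rfl | hlt := hi.eq_or_lt
    · exact (snocHistory_last x s).symm ▸ hs
    · exact (snocHistory_of_le x s (Nat.lt_succ_iff.1 hlt)).symm ▸ hx i (Nat.lt_succ_iff.1 hlt)

theorem measurableSet_targetHistories [Finite Q] {f : (k : ℕ) → X k → Q}
    (hf : ∀ k q, MeasurableSet (f k ⁻¹' {q})) (δ : M → Q → M) (z₀ : M) (live : Set Q)
    (acc : Set (Q × M)) (k : ℕ) : MeasurableSet (targetHistories f δ z₀ live acc k) := by
  let _ : MeasurableSpace Q := ⊤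
  have measurable_f (k : ℕ) : Measurable (f k) := measurable_to_countable' (hf k)
  have measurable_pi : Measurable fun (x : Π i : Iic k, X i) (i : Iic k) => f i (x i) :=
    measurable_pi_lambda _ fun i => (measurable_f _).comp (measurable_pi_apply i)
  exact measurable_pi
    (.of_discrete (s := targetHistories (X := fun _ => Q) (fun _ => id) δ z₀ live acc k))

variable [Fintype Q]

/-- A process with history-dependent transition laws `P` is abstracted by the interval Markov
decision process `I` under the strategy `σ` on the product with a memory: as long as the current
abstract state is in `live`, the law of the next abstract state is feasible for the action chosen by
`σ`. -/
structure IMDP.Abstracts (I : IMDP Q A) (f : (k : ℕ) → X k → Q) (δ : M → Q → M) (z₀ : M)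
    (live : Set Q) (σ : Q × M → A) (P : (k : ℕ) → Kernel (Π i : Iic k, X i) (X (k + 1))) :
    Prop where
  measurableSet_fiber : ∀ k q, MeasurableSet (f k ⁻¹' {q})
  law_mem_feasible : ∀ k (x : Π i : Iic k, X i), (productState f δ z₀ x).1 ∈ live →
    (fun q => (P k x).real (f (k + 1) ⁻¹' {q})) ∈
      I.feasible (productState f δ z₀ x).1 (σ (productState f δ z₀ x))

namespace IMDP.Abstracts

variable [Fintype M] {I : IMDP Q A} {f : (k : ℕ) → X k → Q} {δ : M → Q → M} {z₀ : M} {live : Set Q}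
  {σ : Q × M → A} {P : (k : ℕ) → Kernel (Π i : Iic k, X i) (X (k + 1))} [∀ k, IsMarkovKernel (P k)]
  {acc : Set (Q × M)}

theorem ofReal_lowerIter_le_traj (h : I.Abstracts f δ z₀ live σ P)
    (hdead : ∀ k (x : Π i : Iic k, X i), productState f δ z₀ x ∉ acc → ∀ q ∉ live, ∀ n,
      (I.prod δ).lowerIter acc σ n (q, δ (productState (k := k) f δ z₀ x).2 q) ≤ 0)
    (n : ℕ) {k : ℕ} (x : Π i : Iic k, X i)
    (hx : ∀ i (hi : i ≤ k), f i (x ⟨i, mem_Iic.2 hi⟩) ∈ live) :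
    ENNReal.ofReal ((I.prod δ).lowerIter acc σ n (productState f δ z₀ x)) ≤
      Kernel.traj P k x (reachWithin (targetHistories f δ z₀ live acc) k n) := by
  have hB := measurableSet_targetHistories h.measurableSet_fiber δ z₀ live acc
  set V := (I.prod δ).lowerIter acc σ with hV
  induction n generalizing k with
  | zero =>
    by_cases hacc : productState f δ z₀ x ∈ acc
    · rw [traj_reachWithin_of_mem hB ⟨hx, hacc⟩]
      exact ENNReal.ofReal_le_one.2 (lowerIter_mem_Icc _ _ _ _ _).2
    · rw [hV, lowerIter_zero_of_notMem _ σ hacc, ENNReal.ofReal_zero]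
      exact zero_le
  | succ n ih =>
    by_cases hacc : productState f δ z₀ x ∈ acc
    · rw [traj_reachWithin_of_mem hB ⟨hx, hacc⟩]
      exact ENNReal.ofReal_le_one.2 (lowerIter_mem_Icc _ _ _ _ _).2
    · set z := (productState f δ z₀ x).2
      calc ENNReal.ofReal (V (n + 1) (productState f δ z₀ x))
          ≤ ENNReal.ofReal (∑ q, (P k x).real (f (k + 1) ⁻¹' {q}) * V n (q, δ z q)) :=
            ENNReal.ofReal_le_ofReal <|
              I.prod_lowerIter_succ_le δ hacc (h.law_mem_feasible k x (hx k le_rfl)) n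
        _ = ∫⁻ s, ENNReal.ofReal (V n (f (k + 1) s, δ z (f (k + 1) s))) ∂P k x :=
            (lintegral_ofReal_comp_eq_ofReal_sum (V := fun q => V n (q, δ z q))
              (h.measurableSet_fiber (k + 1)) _ fun q => (lowerIter_mem_Icc _ _ _ _ _).1).symm
        _ ≤ ∫⁻ s, Kernel.traj P (k + 1) (snocHistory x s)
              (reachWithin (targetHistories f δ z₀ live acc) (k + 1) n) ∂P k x := by
            refine lintegral_mono fun s => ?_
            by_cases hs : f (k + 1) s ∈ live
            · simpa only [productState_snocHistory] using
                ih (snocHistory x s) (forall_snocHistory_mem_iff.2 ⟨hx, hs⟩)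
            · rw [ENNReal.ofReal_of_nonpos (hdead k x hacc _ hs n)]
              exact zero_le
        _ = Kernel.traj P k x
              (reachWithin (targetHistories f δ z₀ live acc) k (n + 1)) :=
            (traj_reachWithin_succ_of_notMem hB (fun hB => hacc hB.2) n).symm

theorem traj_le_ofReal_upperIter (h : I.Abstracts f δ z₀ live σ P) (n : ℕ) {k : ℕ}
    (x : Π i : Iic k, X i) :
    Kernel.traj P k x (reachWithin (targetHistories f δ z₀ live acc) k n) ≤
      ENNReal.ofReal ((I.prod δ).upperIter acc σ n (productState f δ z₀ x)) := by
  have hB := measurableSet_targetHistories h.measurableSet_fiber δ z₀ live acc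
  set V := (I.prod δ).upperIter acc σ with hV
  induction n generalizing k with
  | zero =>
    by_cases hacc : productState f δ z₀ x ∈ acc
    · rw [hV, upperIter_of_mem _ σ hacc, ENNReal.ofReal_one]
      exact prob_le_one
    · rw [traj_reachWithin_zero_of_notMem hB fun hB => hacc hB.2]
      exact zero_le
  | succ n ih =>
    by_cases hacc : productState f δ z₀ x ∈ acc
    · rw [hV, upperIter_of_mem _ σ hacc, ENNReal.ofReal_one]
      exact prob_le_one
    by_cases hx : ∀ i (hi : i ≤ k), f i (x ⟨i, mem_Iic.2 hi⟩) ∈ live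
    · set z := (productState f δ z₀ x).2
      calc Kernel.traj P k x
              (reachWithin (targetHistories f δ z₀ live acc) k (n + 1))
          = ∫⁻ s, Kernel.traj P (k + 1) (snocHistory x s)
              (reachWithin (targetHistories f δ z₀ live acc) (k + 1) n) ∂P k x :=
            traj_reachWithin_succ_of_notMem hB (fun hB => hacc hB.2) n
        _ ≤ ∫⁻ s, ENNReal.ofReal (V n (f (k + 1) s, δ z (f (k + 1) s))) ∂P k x := by
            refine lintegral_mono fun s => ?_
            simpa only [productState_snocHistory] using ih (snocHistory x s)
        _ = ENNReal.ofReal (∑ q, (P k x).real (f (k + 1) ⁻¹' {q}) * V n (q, δ z q)) :=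
            lintegral_ofReal_comp_eq_ofReal_sum (V := fun q => V n (q, δ z q))
              (h.measurableSet_fiber (k + 1)) _ fun q => (upperIter_mem_Icc _ _ _ _ _).1
        _ ≤ ENNReal.ofReal (V (n + 1) (productState f δ z₀ x)) :=
            ENNReal.ofReal_le_ofReal <|
              I.le_prod_upperIter_succ δ hacc (h.law_mem_feasible k x (hx k le_rfl)) n
    · rw [traj_reachWithin_eq_zero hB
        (D := fun _ => {x | ¬ ∀ i (hi : i ≤ _), f i (x ⟨i, mem_Iic.2 hi⟩) ∈ live})
        (fun _ => Set.disjoint_left.2 fun _ hD hB => hD hB.1)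
        (fun _ _ hD _ hlive => hD (forall_snocHistory_mem_iff.1 hlive).1) (n + 1) hx]
      exact zero_le

theorem lowerValue_le_traj_real (h : I.Abstracts f δ z₀ live σ P)
    (hdead : ∀ k (x : Π i : Iic k, X i), productState f δ z₀ x ∉ acc → ∀ q ∉ live, ∀ n,
      (I.prod δ).lowerIter acc σ n (q, δ (productState (k := k) f δ z₀ x).2 q) ≤ 0)
    (x₀ : Π i : Iic 0, X i) (hx₀ : f 0 (x₀ ⟨0, mem_Iic.2 le_rfl⟩) ∈ live) :
    (I.prod δ).lowerValue acc σ (productState f δ z₀ x₀) ≤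
      (Kernel.traj P 0 x₀).real
        {ω | ∃ k, frestrictLe k ω ∈ targetHistories f δ z₀ live acc k} := by
  refine ciSup_le fun n => (ENNReal.ofReal_le_iff_le_toReal (by finiteness)).1 <|
    (h.ofReal_lowerIter_le_traj hdead n x₀ fun i hi => ?_).trans <| measure_mono fun ω hω => ?_
  · obtain rfl := Nat.le_zero.1 hi
    exact hx₀
  · obtain ⟨j, -, hj⟩ := mem_reachWithin.1 hω
    exact ⟨j, hj⟩

theorem traj_real_le_upperValue (h : I.Abstracts f δ z₀ live σ P) (x₀ : Π i : Iic 0, X i) :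
    (Kernel.traj P 0 x₀).real {ω | ∃ k, frestrictLe k ω ∈ targetHistories f δ z₀ live acc k} ≤
      (I.prod δ).upperValue acc σ (productState f δ z₀ x₀) := by
  set B := targetHistories f δ z₀ live acc
  have iter_le n := (I.prod δ).upperIter_le_upperValue acc σ n (productState f δ z₀ x₀)
  have iUnion_reach : {ω | ∃ k, frestrictLe k ω ∈ B k} = ⋃ n, reachWithin B 0 n := by
    ext ω
    simp only [Set.mem_ofPred_eq, Set.mem_iUnion, mem_reachWithin]
    exact ⟨fun ⟨k, hk⟩ => ⟨k, k, ⟨k.zero_le, (Nat.zero_add k).ge⟩, hk⟩,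
      fun ⟨_, k, _, hk⟩ => ⟨k, hk⟩⟩
  refine ENNReal.toReal_le_of_le_ofReal
    ((upperIter_mem_Icc _ _ _ 0 _).1.trans (iter_le 0)) ?_
  rw [iUnion_reach, (monotone_reachWithin B 0).measure_iUnion]
  exact iSup_le fun n => (h.traj_le_ofReal_upperIter n x₀).trans <|
    ENNReal.ofReal_le_ofReal (iter_le n)

end IMDP.Abstracts

end Abstraction

/-! ## Gaussian measures and convex null sets -/

section Gaussian

open scoped RealInnerProductSpace

section NormedSpace

variable {E : Type*} [NormedAddCommGroup E] [NormedSpace ℝ E] [MeasurableSpace E]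

theorem exists_strongDual_ne_zero_of_convex_of_measure_eq_zero [FiniteDimensional ℝ E]
    {ν : Measure E} [ν.IsOpenPosMeasure] {C : Set E} (hC : Convex ℝ C) (hν : ν C = 0)
    (hne : C.Nonempty) : ∃ L : StrongDual ℝ E, L ≠ 0 ∧ ∃ c, C ⊆ L ⁻¹' {c} := by
  obtain ⟨p, hp⟩ := hne
  have span_ne_top : affineSpan ℝ C ≠ ⊤ := fun htop =>
    (isOpen_interior.measure_pos ν (hC.interior_nonempty_iff_affineSpan_eq_top.2 htop)).ne'
      (measure_mono_null interior_subset hν)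
  have direction_ne_top : (affineSpan ℝ C).direction ≠ ⊤ :=
    mt (AffineSubspace.direction_eq_top_iff_of_nonempty ⟨p, subset_affineSpan ℝ C hp⟩).1
      span_ne_top
  obtain ⟨L, L_ne_zero, direction_le_ker⟩ := Submodule.exists_le_ker_of_lt_top _
    direction_ne_top.lt_top
  refine ⟨L.toContinuousLinearMap, by simpa using L_ne_zero, L p, fun y hy => ?_⟩
  have hker : L (y - p) = 0 := direction_le_ker <|
    AffineSubspace.vsub_mem_direction (subset_affineSpan ℝ C hy) (subset_affineSpan ℝ C hp)
  simpa [sub_eq_zero] using hker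

variable [BorelSpace E] {μ : Measure E} [IsGaussian μ]

theorem gaussian_preimage_singleton_eq_zero {L : StrongDual ℝ E} (hL : Var[L; μ] ≠ 0) (c : ℝ) :
    μ (L ⁻¹' {c}) = 0 := by
  have hvar : Var[L; μ].toNNReal ≠ 0 :=
    (Real.toNNReal_pos.2 ((variance_nonneg _ _).lt_of_ne' hL)).ne'
  rw [← Measure.map_apply (by fun_prop) (measurableSet_singleton c),
    IsGaussian.map_eq_gaussianReal]
  exact gaussianReal_absolutelyContinuous _ hvar Real.volume_singleton

theorem gaussian_convex_eq_zero [FiniteDimensional ℝ E] {ν : Measure E} [ν.IsOpenPosMeasure]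
    (hμ : ∀ L : StrongDual ℝ E, L ≠ 0 → Var[L; μ] ≠ 0) {C : Set E} (hC : Convex ℝ C)
    (hν : ν C = 0) : μ C = 0 := by
  obtain rfl | hne := C.eq_empty_or_nonempty
  · exact measure_empty
  obtain ⟨L, L_ne_zero, c, hCL⟩ :=
    exists_strongDual_ne_zero_of_convex_of_measure_eq_zero hC hν hne
  exact measure_mono_null hCL (gaussian_preimage_singleton_eq_zero (hμ L L_ne_zero) c)

end NormedSpace

theorem variance_inner_multivariateGaussian {ι : Type*} [Fintype ι] [DecidableEq ι]
    (μ : EuclideanSpace ℝ ι) {S : Matrix ι ι ℝ} (hS : S.PosSemidef) (u : EuclideanSpace ℝ ι) :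
    Var[fun w => ⟪u, w⟫; multivariateGaussian μ S] = u.ofLp ⬝ᵥ S.mulVec u.ofLp := by
  rw [← covarianceBilin_multivariateGaussian hS, covarianceBilin_self IsGaussian.memLp_two_id]

namespace SHS

variable {A Υ : Type*} {m r : ℕ} [Finite A] [MeasurableSpace A] [DiscreteMeasurableSpace A]
  (H : SHS A Υ m r)

theorem T_apply (a : A) (x : EuclideanSpace ℝ (Fin m)) : H.T (a, x) =
    ((multivariateGaussian 0 H.cov).map (H.G a).toEuclideanLin.toContinuousLinearMap).map
      ((H.F a).toEuclideanLin x + ·) := by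
  rw [Measure.map_map (by fun_prop) (by fun_prop)]
  rfl

instance isGaussian_T (p : A × EuclideanSpace ℝ (Fin m)) : IsGaussian (H.T p) := by
  rw [← p.eta, T_apply]
  infer_instance

theorem variance_inner_T (a : A) (x v : EuclideanSpace ℝ (Fin m)) :
    Var[fun y => ⟪v, y⟫; H.T (a, x)] =
      v.ofLp ⬝ᵥ (H.G a * H.cov * (H.G a).transpose).mulVec v.ofLp := by
  let u := (H.G a).transpose.toEuclideanLin v
  have adjoint w : ⟪v, (H.G a).toEuclideanLin w⟫ = ⟪u, w⟫ := by
    rw [← LinearMap.adjoint_inner_left, ← Matrix.toEuclideanLin_conjTranspose_eq_adjoint,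
      Matrix.conjTranspose_eq_transpose_of_trivial]
  calc Var[fun y => ⟪v, y⟫; H.T (a, x)]
      = Var[fun w => ⟪v, (H.F a).toEuclideanLin x⟫ + ⟪u, w⟫; multivariateGaussian 0 H.cov] := by
        rw [T_apply, Measure.map_map (by fun_prop) (by fun_prop),
          variance_map (by fun_prop) (by fun_prop)]
        congr 1 with w
        simp [inner_add_right, adjoint]
    _ = u.ofLp ⬝ᵥ H.cov.mulVec u.ofLp := by
        rw [variance_const_add (by fun_prop),
          variance_inner_multivariateGaussian 0 H.cov_posSemidef]
    _ = v.ofLp ⬝ᵥ (H.G a * H.cov * (H.G a).transpose).mulVec v.ofLp := by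
        rw [← Matrix.mulVec_mulVec, ← Matrix.mulVec_mulVec, Matrix.dotProduct_mulVec v.ofLp,
          ← Matrix.mulVec_transpose]
        rfl

theorem T_eq_zero_of_convex {a : A} (hG : (H.G a * H.cov * (H.G a).transpose).PosDef)
    (x : EuclideanSpace ℝ (Fin m)) {C : Set (EuclideanSpace ℝ (Fin m))} (hC : Convex ℝ C)
    (hvol : volume C = 0) : H.T (a, x) C = 0 := by
  refine gaussian_convex_eq_zero (fun L hL => ?_) hC hvol
  obtain ⟨v, rfl⟩ := (InnerProductSpace.toDual ℝ (EuclideanSpace ℝ (Fin m))).surjective L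
  have hv : v ≠ 0 := fun hv => hL (by simp [hv])
  have hpos := hG.dotProduct_mulVec_pos (x := v.ofLp) (by simpa using hv)
  exact (H.variance_inner_T a x v).trans_ne hpos.ne'

end SHS

end Gaussian

/-! ## One step of the abstraction -/

section Step

variable {A Υ : Type*} {m r : ℕ} {X : Set (EuclideanSpace ℝ (Fin m))} {Cell : A → Type*}
  {D : Discretization X Cell}

theorem Discretization.convex_cell (D : Discretization X Cell) (a : A) (c : Cell a) :
    Convex ℝ (D.cell a c) := by
  obtain ⟨V, hV⟩ := D.polytope a c
  exact hV ▸ convex_convexHull ℝ _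

section Quantizer

variable [MeasurableSpace A] (κ : Quantizer D)

theorem Quantizer.abs_eq_none_iff {s : A × EuclideanSpace ℝ (Fin m)} :
    κ.abs s = none ↔ s.2 ∉ X := by
  refine ⟨fun h hs => ?_, κ.outside s.1 s.2⟩
  obtain ⟨c, hc, -⟩ := κ.inside s.1 s.2 hs
  exact Option.some_ne_none _ (hc.symm.trans h)

theorem Quantizer.mem_cell_of_abs_eq {s : A × EuclideanSpace ℝ (Fin m)} {i : Σ a, Cell a}
    (h : κ.abs s = some i) : i.1 = s.1 ∧ s.2 ∈ D.cell i.1 i.2 := by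
  have hs : s.2 ∈ X := by
    by_contra hs
    exact Option.some_ne_none _ (h.symm.trans (κ.abs_eq_none_iff.2 hs))
  obtain ⟨c, hc, hmem⟩ := κ.inside s.1 s.2 hs
  cases Option.some_injective _ (h.symm.trans hc)
  exact ⟨rfl, hmem⟩

theorem Quantizer.preimage_mk_none (a : A) : (fun y => κ.abs (a, y)) ⁻¹' {none} = Xᶜ :=
  Set.ext fun _ => κ.abs_eq_none_iff

theorem Quantizer.preimage_mk_some_of_ne {a : A} {i : Σ a, Cell a} (hi : i.1 ≠ a) :
    (fun y => κ.abs (a, y)) ⁻¹' {some i} = ∅ :=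
  Set.eq_empty_of_forall_notMem fun _ hy => hi (κ.mem_cell_of_abs_eq hy).1

theorem Quantizer.measurableSet_preimage_mk (a : A) (q : AbsState Cell) :
    MeasurableSet ((fun y => κ.abs (a, y)) ⁻¹' {q}) :=
  measurable_prodMk_left (κ.measurableSet_fiber q)

theorem Quantizer.preimage_mk_some_ae_eq_cell {a : A} [Countable (Cell a)]
    {μ : Measure (EuclideanSpace ℝ (Fin m))}
    (hμ : ∀ c c', c ≠ c' → μ (D.cell a c ∩ D.cell a c') = 0) (c : Cell a) :
    (fun y => κ.abs (a, y)) ⁻¹' {some ⟨a, c⟩} =ᵐ[μ] D.cell a c := by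
  refine Filter.EventuallyLE.antisymm
    (LE.le.eventuallyLE fun y hy => (κ.mem_cell_of_abs_eq hy).2) (ae_le_set.2 ?_)
  refine measure_mono_null (t := ⋃ c' : {c' : Cell a // c' ≠ c}, D.cell a c ∩ D.cell a c') ?_
    (measure_iUnion_null fun c' => hμ c c' c'.2.symm)
  rintro y ⟨hy, hne⟩
  obtain ⟨c', hc', hmem⟩ := κ.inside a y (D.cover a ▸ Set.mem_iUnion.2 ⟨c, hy⟩)
  refine Set.mem_iUnion.2 ⟨⟨c', ?_⟩, hy, hmem⟩
  rintro rfl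
  exact hne hc'

end Quantizer

section Kernel

variable [Finite A] [MeasurableSpace A] [DiscreteMeasurableSpace A]

instance SHS.isProbabilityMeasure_pathMeasure (H : SHS A Υ m r)
    (σ : SwitchingStrategy A m) (s₀ : A × EuclideanSpace ℝ (Fin m)) :
    IsProbabilityMeasure (H.pathMeasure σ s₀) := by
  unfold SHS.pathMeasure
  infer_instance

theorem SHS.stepKernel_real_apply (H : SHS A Υ m r) (σ : SwitchingStrategy A m) {k : ℕ}
    (h : Finset.Iic k → A × EuclideanSpace ℝ (Fin m))
    {S : Set (A × EuclideanSpace ℝ (Fin m))} (hS : MeasurableSet S) :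
    (H.stepKernel σ k h).real S =
      (H.T (σ.act k h, (h ⟨k, Finset.mem_Iic.2 le_rfl⟩).2)).real (Prod.mk (σ.act k h) ⁻¹' S) := by
  rw [SHS.stepKernel, Kernel.comap_apply, Kernel.prod_apply, Kernel.deterministic_apply,
    Measure.dirac_prod, map_measureReal_apply measurable_prodMk_left hS]

theorem SHS.T_real_mem_Icc (H : SHS A Υ m r) (a : A) (B : Set (EuclideanSpace ℝ (Fin m)))
    {C : Set (EuclideanSpace ℝ (Fin m))} {x : EuclideanSpace ℝ (Fin m)} (hx : x ∈ C) :
    (H.T (a, x)).real B ∈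
      Set.Icc (⨅ y : C, (H.T (a, (y : EuclideanSpace ℝ (Fin m)))).real B)
        (⨆ y : C, (H.T (a, (y : EuclideanSpace ℝ (Fin m)))).real B) :=
  ⟨ciInf_le ⟨0, Set.forall_mem_range.2 fun _ => measureReal_nonneg⟩ (⟨x, hx⟩ : C),
    le_ciSup (f := fun y : C => (H.T (a, (y : EuclideanSpace ℝ (Fin m)))).real B)
      ⟨1, Set.forall_mem_range.2 fun _ => measureReal_le_one⟩ ⟨x, hx⟩⟩

end Kernel

variable [Fintype A] [MeasurableSpace A] [DiscreteMeasurableSpace A] [∀ a, Fintype (Cell a)]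
  {H : SHS A Υ m r}

open Classical in
theorem Discretization.single_none_mem_feasible (D : Discretization X Cell) (H : SHS A Υ m r)
    (a : A) : (Pi.single none 1 : AbsState Cell → ℝ) ∈ (D.imdp H).feasible none a := by
  refine ⟨single_mem_stdSimplex ℝ none, fun q => ?_⟩
  cases q <;> simp [Discretization.imdp]

theorem Quantizer.T_real_preimage_mk_mem_feasible (κ : Quantizer D) {a : A} {i : Σ a, Cell a}
    {x : EuclideanSpace ℝ (Fin m)} (hx : x ∈ D.cell i.1 i.2)
    (hT : ∀ c c', c ≠ c' → H.T (a, x) (D.cell a c ∩ D.cell a c') = 0) :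
    (fun q => (H.T (a, x)).real ((fun y => κ.abs (a, y)) ⁻¹' {q})) ∈
      (D.imdp H).feasible (some i) a := by
  refine ⟨⟨fun q => measureReal_nonneg, ?_⟩, ?_⟩
  · rw [sum_measureReal_preimage_singleton _ fun q _ => κ.measurableSet_preimage_mk a q]
    simp
  rintro (_ | ⟨b, c⟩) <;> beta_reduce
  · have measurableSet_X : MeasurableSet X :=
      .of_compl (κ.preimage_mk_none a ▸ κ.measurableSet_preimage_mk a none)
    obtain ⟨hinf, hsup⟩ := H.T_real_mem_Icc a X hx
    rw [κ.preimage_mk_none, probReal_compl_eq_one_sub measurableSet_X]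
    exact ⟨sub_le_sub_left hsup 1, sub_le_sub_left hinf 1⟩
  · by_cases hb : b = a
    · subst hb
      rw [measureReal_congr (κ.preimage_mk_some_ae_eq_cell hT c)]
      simpa only [Discretization.imdp, if_true] using
        Set.mem_Icc.1 (H.T_real_mem_Icc b (D.cell b c) hx)
    · simp [Discretization.imdp, hb, κ.preimage_mk_some_of_ne (i := ⟨b, c⟩) hb]

theorem Quantizer.abstracts_stepKernel (κ : Quantizer D)
    (hT : ∀ a x c c', c ≠ c' → H.T (a, x) (D.cell a c ∩ D.cell a c') = 0) {M : Type*}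
    {δ : M → AbsState Cell → M} {z₀ : M} {σ : AbsState Cell × M → A} {τ : SwitchingStrategy A m}
    (hτ : ∀ k h, τ.act k h =
      σ (productState (X := fun _ => A × EuclideanSpace ℝ (Fin m)) (fun _ => κ.abs) δ z₀ h)) :
    (D.imdp H).Abstracts (X := fun _ => A × EuclideanSpace ℝ (Fin m)) (fun _ => κ.abs) δ z₀
      {none}ᶜ σ (H.stepKernel τ) where
  measurableSet_fiber _ := κ.measurableSet_fiber
  law_mem_feasible k h hlive := by
    obtain ⟨i, hi⟩ := Option.ne_none_iff_exists'.1 hlive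
    have law_eq (q : AbsState Cell) := H.stepKernel_real_apply τ h (κ.measurableSet_fiber q)
    rw [hi, ← hτ]
    simp only [law_eq]
    exact κ.T_real_preimage_mk_mem_feasible (κ.mem_cell_of_abs_eq hi).2 (hT _ _)

end Step

/-! ## Labels and good prefixes -/

section Labels

variable {A Υ : Type*} {m r : ℕ} {X : Set (EuclideanSpace ℝ (Fin m))} {Cell : A → Type*}

theorem SHS.mem_litRegion_iff {H : SHS A Υ m r} {s : A × EuclideanSpace ℝ (Fin m)}
    (hs : s.2 ∈ X) {p : Υ ⊕ Υ} : s.2 ∈ H.litRegion X p ↔ p ∈ litSet (H.label s) := by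
  cases p with
  | inl p => rw [inl_mem_litSet]; rfl
  | inr p => rw [inr_mem_litSet]; exact and_iff_right hs

variable [MeasurableSpace A] {D : Discretization X Cell}

theorem Quantizer.labelUnder_abs_subset (κ : Quantizer D) (H : SHS A Υ m r)
    (s : A × EuclideanSpace ℝ (Fin m)) : D.labelUnder H (κ.abs s) ⊆ litSet (H.label s) := by
  cases hi : κ.abs s with
  | none => exact Set.empty_subset _
  | some i =>
    have hs : s.2 ∈ X := not_not.1 <| κ.abs_eq_none_iff.not.1 (hi ▸ Option.some_ne_none i)
    exact fun p hp => (H.mem_litRegion_iff hs).1 (hp (κ.mem_cell_of_abs_eq hi).2)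

theorem Quantizer.subset_labelOver_abs (κ : Quantizer D) (H : SHS A Υ m r)
    {s : A × EuclideanSpace ℝ (Fin m)} (hs : s.2 ∈ X) :
    litSet (H.label s) ⊆ D.labelOver H (κ.abs s) := by
  cases hi : κ.abs s with
  | none => exact absurd hs (κ.abs_eq_none_iff.1 hi)
  | some i =>
    exact fun p hp => ⟨s.2, (κ.mem_cell_of_abs_eq hi).2, (SHS.mem_litRegion_iff hs).2 hp⟩

variable {φ : Spec Υ} {Z : Type*} {𝒜 : DFA (Set (Υ ⊕ Υ)) Z}

/-- The finite paths that stay in `A × X` and have a trace that is a good prefix of `φ`. -/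
def SHS.satHistories (H : SHS A Υ m r) (X : Set (EuclideanSpace ℝ (Fin m))) (φ : Spec Υ) (k : ℕ) :
    Set (Finset.Iic k → A × EuclideanSpace ℝ (Fin m)) :=
  {h | (∀ i (hi : i ≤ k), (h ⟨i, Finset.mem_Iic.2 hi⟩).2 ∈ X) ∧ φ.IsGoodPrefix
    (historyTrace (X := fun _ => A × EuclideanSpace ℝ (Fin m)) (fun _ => H.label) h)}

theorem Quantizer.targetHistories_subset_satHistories (κ : Quantizer D) (H : SHS A Υ m r)
    (h𝒜 : ∀ w ∈ 𝒜.accepts, φ.IsGoodPrefixBar w) (k : ℕ) :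
    targetHistories (X := fun _ => A × EuclideanSpace ℝ (Fin m)) (fun _ => κ.abs)
      (fun z q => 𝒜.step z (D.labelUnder H q)) 𝒜.start {none}ᶜ (accUnder Cell 𝒜) k ⊆
      H.satHistories X φ k := by
  rintro h ⟨hlive, hacc⟩
  refine ⟨fun i hi => not_not.1 (κ.abs_eq_none_iff.not.1 (hlive i hi)), ?_⟩
  rw [productState_dfa_step] at hacc
  rw [← φ.isGoodPrefixBar_map_litSet, map_historyTrace]
  exact (h𝒜 _ hacc).mono (forall₂_historyTrace fun i hi => κ.labelUnder_abs_subset H _)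

theorem Quantizer.satHistories_subset_targetHistories (κ : Quantizer D) (H : SHS A Υ m r)
    (h𝒜 : ∀ w, φ.IsGoodPrefixBar w → w ∈ 𝒜.accepts) (k : ℕ) :
    H.satHistories X φ k ⊆
      targetHistories (X := fun _ => A × EuclideanSpace ℝ (Fin m)) (fun _ => κ.abs)
        (fun z q => (𝒜.step z.1 (D.labelUnder H q), 𝒜.step z.2 (D.labelOver H q)))
        (𝒜.start, 𝒜.start) {none}ᶜ (accOver Cell 𝒜) k := by
  rintro h ⟨hX, hgood⟩
  refine ⟨fun i hi hnone => κ.abs_eq_none_iff.1 hnone (hX i hi), ?_⟩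
  rw [← φ.isGoodPrefixBar_map_litSet, map_historyTrace] at hgood
  rw [productState_dfa_step_prodMk]
  exact h𝒜 _ (hgood.mono (forall₂_historyTrace fun i hi => κ.subset_labelOver_abs H (hX i hi)))

variable [Fintype A] [DiscreteMeasurableSpace A] [∀ a, Fintype (Cell a)] [Fintype Z]

theorem Discretization.lowerIter_productUnder_none_nonpos (D : Discretization X Cell)
    (H : SHS A Υ m r) (h𝒜 : ∀ w, w ∈ 𝒜.accepts ↔ φ.IsGoodPrefixBar w)
    (σ : AbsState Cell × Z → A) {w : List (Set (Υ ⊕ Υ))} (hw : 𝒜.eval w ∉ 𝒜.accept) (n : ℕ) :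
    (D.productUnder H 𝒜).lowerIter (accUnder Cell 𝒜) σ n (none, 𝒜.step (𝒜.eval w) ∅) ≤ 0 := by
  classical
  -- The memory of a run that has left `A × X` only reads `∅`.
  have step_notMem {w} (hw : 𝒜.eval w ∉ 𝒜.accept) : 𝒜.step (𝒜.eval w) ∅ ∉ 𝒜.accept := by
    rw [← 𝒜.eval_append_singleton]
    exact fun hmem => hw ((h𝒜 w).2 ((h𝒜 _).1 hmem).of_append_empty)
  refine (D.imdp H).prod_lowerIter_nonpos_of_absorbing _ σ (q := none)
    (D.single_none_mem_feasible H) (N := {z | z ∉ 𝒜.accept ∧ ∃ w, 𝒜.eval w = z})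
    (fun z hz => hz.1) ?_ n ⟨step_notMem hw, w ++ [∅], 𝒜.eval_append_singleton w ∅⟩
  rintro _ ⟨hz, w', rfl⟩
  exact ⟨step_notMem hz, w' ++ [∅], 𝒜.eval_append_singleton w' ∅⟩

end Labels

section SatProb

variable {A Υ Z : Type*} [Fintype A] [MeasurableSpace A] [DiscreteMeasurableSpace A] [Fintype Z]
  {m r : ℕ} {H : SHS A Υ m r} {X : Set (EuclideanSpace ℝ (Fin m))} {Cell : A → Type*}
  [∀ a, Fintype (Cell a)] {D : Discretization X Cell} {φ : Spec Υ} {𝒜 : DFA (Set (Υ ⊕ Υ)) Z}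

theorem Quantizer.lowerValue_le_satProb (κ : Quantizer D)
    (hT : ∀ a x c c', c ≠ c' → H.T (a, x) (D.cell a c ∩ D.cell a c') = 0)
    (h𝒜 : ∀ w, w ∈ 𝒜.accepts ↔ φ.IsGoodPrefixBar w) (σ : AbsState Cell × Z → A)
    {s₀ : A × EuclideanSpace ℝ (Fin m)} (hs₀ : s₀.2 ∈ X) :
    (D.productUnder H 𝒜).lowerValue (accUnder Cell 𝒜) σ
        (κ.abs s₀, 𝒜.step 𝒜.start (D.labelUnder H (κ.abs s₀))) ≤
      H.satProb X φ (κ.refine (D.labelUnder H) 𝒜 σ) s₀ := by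
  have abstracts := κ.abstracts_stepKernel hT (τ := κ.refine (D.labelUnder H) 𝒜 σ) (σ := σ)
    (δ := fun z q => 𝒜.step z (D.labelUnder H q)) (z₀ := 𝒜.start)
    fun k h => by rw [productState_dfa_step]; rfl
  refine (abstracts.lowerValue_le_traj_real (fun k x hacc q hq n => ?_) (fun _ => s₀) ?_).trans ?_
  · rw [productState_dfa_step] at hacc ⊢
    rw [Set.notMem_compl_iff.1 hq]
    exact D.lowerIter_productUnder_none_nonpos H h𝒜 σ hacc n
  · exact fun hnone => κ.abs_eq_none_iff.1 hnone hs₀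
  · exact measureReal_mono fun ω ⟨k, hk⟩ =>
      ⟨k, κ.targetHistories_subset_satHistories H (fun w => (h𝒜 w).1) k hk⟩

theorem Quantizer.satProb_le_upperBound (κ : Quantizer D)
    (hT : ∀ a x c c', c ≠ c' → H.T (a, x) (D.cell a c ∩ D.cell a c') = 0)
    (h𝒜 : ∀ w, φ.IsGoodPrefixBar w → w ∈ 𝒜.accepts) (σ : AbsState Cell × Z → A)
    (s₀ : A × EuclideanSpace ℝ (Fin m)) :
    H.satProb X φ (κ.refine (D.labelUnder H) 𝒜 σ) s₀ ≤ D.upperBound H 𝒜 σ (κ.abs s₀) := by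
  have abstracts := κ.abstracts_stepKernel hT (τ := κ.refine (D.labelUnder H) 𝒜 σ)
    (σ := fun s => σ (s.1, s.2.1)) (z₀ := (𝒜.start, 𝒜.start))
    (δ := fun z q => (𝒜.step z.1 (D.labelUnder H q), 𝒜.step z.2 (D.labelOver H q)))
    fun k h => by rw [productState_dfa_step_prodMk]; rfl
  refine (measureReal_mono ?_).trans (abstracts.traj_real_le_upperValue fun _ => s₀)
  exact fun ω ⟨k, hk⟩ => ⟨k, κ.satHistories_subset_targetHistories H h𝒜 k hk⟩

end SatProb

theorem mainTheorem2_general {A Υ Z : Type*} [Fintype A] [MeasurableSpace A]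
    [DiscreteMeasurableSpace A] [Fintype Z] {m r : ℕ} (H : SHS A Υ m r)
    {X : Set (EuclideanSpace ℝ (Fin m))} {Cell : A → Type*} [∀ a, Fintype (Cell a)]
    (D : Discretization X Cell)
    (hT : ∀ a x c c', c ≠ c' → H.T (a, x) (D.cell a c ∩ D.cell a c') = 0) (κ : Quantizer D)
    (φ : Spec Υ) (𝒜 : DFA (Set (Υ ⊕ Υ)) Z)
    (h𝒜 : ∀ w, w ∈ 𝒜.accepts ↔ φ.IsGoodPrefixBar w) (σ : AbsState Cell × Z → A)
    (s₀ : A × EuclideanSpace ℝ (Fin m)) (hs₀ : s₀.2 ∈ X) :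
    (D.productUnder H 𝒜).lowerValue (accUnder Cell 𝒜) σ
        (κ.abs s₀, 𝒜.step 𝒜.start (D.labelUnder H (κ.abs s₀))) ≤
        H.satProb X φ (κ.refine (D.labelUnder H) 𝒜 σ) s₀ ∧
      H.satProb X φ (κ.refine (D.labelUnder H) 𝒜 σ) s₀ ≤ D.upperBound H 𝒜 σ (κ.abs s₀) :=
  ⟨κ.lowerValue_le_satProb hT h𝒜 σ hs₀, κ.satProb_le_upperBound hT (fun w => (h𝒜 w).2) σ s₀⟩

theorem mainTheorem2 {A Υ Z : Type*} [Fintype A] [MeasurableSpace A] [DiscreteMeasurableSpace A]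
    [Finite Υ] [Fintype Z] {m r : ℕ}
    (H : SHS A Υ m r) (hG : ∀ a, (H.G a * H.cov * (H.G a).transpose).PosDef)
    (X : Set (EuclideanSpace ℝ (Fin m))) (hX : IsCompact X)
    (hclosed : ∀ p, IsClosed (H.region p)) (hsub : ∀ p, H.region p ⊆ X)
    {Cell : A → Type*} [∀ a, Fintype (Cell a)]
    (D : Discretization X Cell) (κ : Quantizer D)
    (φ : Spec Υ) (𝒜 : DFA (Set (Υ ⊕ Υ)) Z)
    (h𝒜 : ∀ w, w ∈ 𝒜.accepts ↔ φ.IsGoodPrefixBar w)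
    (σ : AbsState Cell × Z → A)
    (hσ : (D.productUnder H 𝒜).IsOptimal (accUnder Cell 𝒜) σ)
    (s₀ : A × EuclideanSpace ℝ (Fin m)) (hs₀ : s₀.2 ∈ X) :
    D.lowerBound H 𝒜 (κ.abs s₀) ≤ H.satProb X φ (κ.refine (D.labelUnder H) 𝒜 σ) s₀ ∧
      H.satProb X φ (κ.refine (D.labelUnder H) 𝒜 σ) s₀ ≤ D.upperBound H 𝒜 σ (κ.abs s₀) := by
  rw [Discretization.lowerBound, ← hσ]
  exact mainTheorem2_general H D (fun a x c c' hc => H.T_eq_zero_of_convex (hG a) x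
    ((D.convex_cell a c).inter (D.convex_cell a c')) (D.overlap a c c' hc)) κ φ 𝒜 h𝒜 σ s₀ hs₀
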